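/- **Conventions.** A locally ordered category is a category with preordered hom-sets and monotone composition; $f\cong g$ means $f\le g\le f$. A 2-functor is a functor that is monotone on hom-sets; it is a biequivalence if it is an equivalence of preorders on each hom-set and every object of the codomain is equivalent to one in its image. A 2-functor $F:\mathcal C\to\mathcal D$ is left adjoint to $U:\mathcal D\to\mathcal C$ with unit $\eta:1\Rightarrow UF$ if each map $\mathcal D(FX,A)\to\mathcal C(X,UA)$, $g\mapsto Ug\circ\eta_X$, is an equivalence of preorders. A KZ doctrine is a monad $(T,\eta,\mu)$ on a locally ordered category, with $T$ a 2-functor, such that $T(\eta_C)\le\eta_{TC}$ for all $C$. An algebra is an arrow $a:TA\to A$ with $a\circ\eta_A\cong 1_A$ and $a\circ\mu_A\cong a\circ Ta$; a homomorphism $(A,a)\to(B,b)$ is an arrow $f:A\to B$ with $f\circ a\cong b\circ Tf$; homomorphisms are ordered as arrows $A\to B$. A quantaloid is a category enriched in $\mathsf{Sup}$ (complete lattices and supremum-preserving maps). Let $\mathcal Q$ be a small quantaloid. $\mathsf{Mod}(\mathcal Q)$ is the quantaloid of $\mathsf{Sup}$-functors $\mathcal Q^{\mathrm{op}}\to\mathsf{Sup}$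 and natural transformations. $\mathsf{Idm}(\mathcal Q)$ is the quantaloid whose objects are the idempotents of $\mathcal Q$, an arrow $e\to f$ being an arrow $b$ of $\mathcal Q$ with $b\circ e=b=f\circ b$, and the identity on $e$ being $e$. Let $\mathcal R$ be a small quantaloid. An $\mathcal R$-category $\mathbb A$ has a set of objects $a$ with types $ta\in\mathcal R_0$ and hom-arrows $\mathbb A(a',a):ta\to ta'$ with $\mathbb A(a'',a')\circ\mathbb A(a',a)\le\mathbb A(a'',a)$ and $1_{ta}\le\mathbb A(a,a)$. A functor is a type-preserving map of objects with $\mathbb A(a',a)\le\mathbb B(Fa',Fa)$; $F\le G$ means $1_{ta}\le\mathbb B(Fa,Ga)$ for all $a$. A distributor $\Phi:\mathbb A\nrightarrow\mathbb B$ is a family of arrows $\Phi(b,a):ta\to tb$ with $\mathbb B(b,b')\circ\Phi(b',a)\le\Phi(b,a)$ and $\Phi(b,a')\circ\mathbb A(a',a)\le\Phi(b,a)$. Distributors are ordered elementwise and compose by $(\Psi\otimes\Phi)(c,a)=\bigvee_b\Psi(c,b)\circ\Phi(b,a)$; $\mathbb A$ itself is the identity distributor on $\mathbb A$. A functor $K:\mathbb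 A\to\mathbb C$ is the $\Phi$-weighted colimit of $F:\mathbb B\to\mathbb C$ if $\mathbb C(K-,-)=[\Phi,\mathbb C(F-,-)]$, where $[\Phi,-]$ is right adjoint to $\Phi\otimes-$. An $\mathcal R$-category is cocomplete if it has all weighted colimits; a functor is cocontinuous if it preserves all weighted colimits existing in its domain. $\mathbb C$ is Cauchy complete if every left adjoint distributor into $\mathbb C$ is of the form $\mathbb C(-,F-)$ for a functor $F$. $\mathsf{Cocont}(\mathcal R)$ is the locally ordered category of cocomplete $\mathcal R$-categories and cocontinuous functors, and $\mathsf{Cat}_{\mathsf{cc}}(\mathcal R)$ that of Cauchy complete $\mathcal R$-categories and all functors. Every cocomplete $\mathcal R$-category is Cauchy complete; let $\mathcal U:\mathsf{Cocont}(\mathcal R)\to\mathsf{Cat}_{\mathsf{cc}}(\mathcal R)$ be the forgetful 2-functor. The $\mathcal R$-category $\mathcal P\mathbb A$ has as objects of type $X$ the presheaves of type $X$ on $\mathbb A$, that is, families of arrows $\varphi(a):X\to ta$ with $\mathbb A(a,a')\circ\varphi(a')\le\varphi(a)$, and hom-arrows $\mathcal P\mathbb A(\psi,\varphi)=\bigvee\{f\mid\psi(a)\circ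 f\le\varphi(a)\text{ for all }a\}$. It is cocomplete, and with $(\mathcal PF)(\varphi)=\mathbb B(-,F-)\otimes\varphi$ for $F:\mathbb A\to\mathbb B$ this gives a 2-functor $\mathcal P:\mathsf{Cat}_{\mathsf{cc}}(\mathcal R)\to\mathsf{Cocont}(\mathcal R)$. The Yoneda embedding $Y_{\mathbb A}:\mathbb A\to\mathcal P\mathbb A$ sends $a$ to $\mathbb A(-,a)$. **Theorem.** Let $\mathcal Q$ be a small quantaloid, and let $\mathsf{Ord}(\mathcal Q)=\mathsf{Cat}_{\mathsf{cc}}(\mathsf{Idm}(\mathcal Q))$ be the locally ordered category of $\mathcal Q$-orders. 1. $\mathcal P:\mathsf{Ord}(\mathcal Q)\to\mathsf{Cocont}(\mathsf{Idm}(\mathcal Q))$ is left adjoint to $\mathcal U:\mathsf{Cocont}(\mathsf{Idm}(\mathcal Q))\to\mathsf{Ord}(\mathcal Q)$, with unit the Yoneda embeddings. 2. The monad induced by this adjunction, with functor part $\mathcal U\mathcal P$, unit $Y$, and multiplication $\mathcal P\mathcal P\mathbb A\to\mathcal P\mathbb A$ given by $\Theta\mapsto\bigvee_{\varphi}\varphi(-)\circ\Theta(\varphi)$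 (this is $\mathcal U\varepsilon_{\mathcal P\mathbb A}$, for $\varepsilon$ the counit), is a KZ doctrine on $\mathsf{Ord}(\mathcal Q)$. 3. There are biequivalences $\mathsf{Mod}(\mathcal Q)\simeq\mathsf{Cocont}(\mathsf{Idm}(\mathcal Q))\simeq\mathsf{Ord}(\mathcal Q)^{\mathcal U\mathcal P}$, where $\mathsf{Ord}(\mathcal Q)^{\mathcal U\mathcal P}$ is the category of algebras for this KZ doctrine, and the second one commutes with the forgetful functors to $\mathsf{Ord}(\mathcal Q)$. In particular the quantaloid $\mathsf{Mod}(\mathcal Q)$ is biequivalent to the category of algebras for the presheaf KZ doctrine on $\mathsf{Ord}(\mathcal Q)$. -/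

import Mathlib

open CategoryTheory

namespace QSup

universe w v u w' v' u' v'' u''

section LocallyOrdered

/-! ### Locally ordered categories, 2-functors, biequivalences, adjunctions, KZ doctrines

The hom-sets of a locally ordered category are preordered; "isomorphism" of parallel arrows is
`AntisymmRel (· ≤ ·)`, written `f ≈₂ g`. -/

/-- A locally ordered category: preordered hom-sets and monotone composition. -/
class LocallyOrdered (C : Type u) [Category.{v} C] where
  homPreorder (X Y : C) : Preorder (X ⟶ Y)
  comp_le_comp {X Y Z : C} {f f' : X ⟶ Y} {g g' : Y ⟶ Z} :
    f ≤ f' → g ≤ g' → f ≫ g ≤ f' ≫ g'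

attribute [reducible, instance] LocallyOrdered.homPreorder

/-- Isomorphism in a preorder: each is below the other. -/
abbrev Iso2 {α : Type u} [Preorder α] (x y : α) : Prop := AntisymmRel (· ≤ ·) x y

infix:50 " ≈₂ " => Iso2

/-- A 2-functor between locally ordered categories. -/
structure TwoFunctor (C : Type u) [Category.{v} C] [LocallyOrdered C]
    (D : Type u') [Category.{v'} D] [LocallyOrdered D] extends C ⥤ D where
  map_mono {X Y : C} {f g : X ⟶ Y} : f ≤ g → toFunctor.map f ≤ toFunctor.map g

/-- Composition of 2-functors. -/
def TwoFunctor.comp {C : Type u} [Category.{v} C] [LocallyOrdered C]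
    {D : Type u'} [Category.{v'} D] [LocallyOrdered D]
    {E : Type u''} [Category.{v''} E] [LocallyOrdered E]
    (F : TwoFunctor C D) (G : TwoFunctor D E) : TwoFunctor C E where
  toFunctor := F.toFunctor ⋙ G.toFunctor
  map_mono h := G.map_mono (F.map_mono h)

/-- A map between preorders is an equivalence (of preorders viewed as categories): it preserves
and reflects the order, and is surjective up to isomorphism. -/
def IsPreorderEquiv {α : Type u} {β : Type v} [Preorder α] [Preorder β] (h : α → β) : Prop :=
  (∀ x y, x ≤ y ↔ h x ≤ h y) ∧ ∀ z, ∃ x, h x ≈₂ z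

/-- Two objects of a locally ordered category are equivalent. -/
def Equivalent₂ {C : Type u} [Category.{v} C] [LocallyOrdered C] (X Y : C) : Prop :=
  ∃ (f : X ⟶ Y) (g : Y ⟶ X), f ≫ g ≈₂ 𝟙 X ∧ g ≫ f ≈₂ 𝟙 Y

/-- A 2-functor is a biequivalence when it is an equivalence on each hom-preorder and surjective
on objects up to equivalence. -/
def TwoFunctor.IsBiequivalence {C : Type u} [Category.{v} C] [LocallyOrdered C]
    {D : Type u'} [Category.{v'} D] [LocallyOrdered D] (F : TwoFunctor C D) : Prop :=
  (∀ X Y : C, IsPreorderEquiv (fun f : X ⟶ Y => F.toFunctor.map f)) ∧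
  ∀ Z : D, ∃ X : C, Equivalent₂ (F.toFunctor.obj X) Z

/-- `F` is left adjoint to `U` with unit `η`, in the 2-categorical sense: for all `X`, `A`, the map
`D(F X, A) → C(X, U A)`, `g ↦ U g ∘ η_X`, is an equivalence of preorders. -/
def IsLeftAdjoint₂ {C : Type u} [Category.{v} C] [LocallyOrdered C]
    {D : Type u'} [Category.{v'} D] [LocallyOrdered D] (F : TwoFunctor C D) (U : TwoFunctor D C)
    (η : 𝟭 C ⟶ F.toFunctor ⋙ U.toFunctor) : Prop :=
  ∀ (X : C) (A : D),
    IsPreorderEquiv (fun g : F.toFunctor.obj X ⟶ A => η.app X ≫ U.toFunctor.map g)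

/-- A monad on a locally ordered category (in the 2-categorical sense). -/
structure TwoMonad (C : Type u) [Category.{v} C] [LocallyOrdered C] extends Monad C where
  map_mono {X Y : C} {f g : X ⟶ Y} : f ≤ g → toFunctor.map f ≤ toFunctor.map g

/-- A Kock-Zöberlein doctrine: a monad with `T(η_C) ≤ η_{T C}` for every `C`. -/
def TwoMonad.IsKZ {C : Type u} [Category.{v} C] [LocallyOrdered C] (T : TwoMonad C) : Prop :=
  ∀ X : C, T.toMonad.map (T.toMonad.η.app X) ≤ T.toMonad.η.app (T.toMonad.obj X)

section Algebras

variable {C : Type u} [Category.{v} C] [LocallyOrdered C]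

/-- An (Eilenberg-Moore) algebra for a monad on a locally ordered category; the axioms hold up to
isomorphism of parallel arrows (coherence of these isomorphisms is automatic here). -/
structure Alg (T : TwoMonad C) where
  carrier : C
  str : T.toMonad.obj carrier ⟶ carrier
  unit : T.toMonad.η.app carrier ≫ str ≈₂ 𝟙 carrier
  assoc : T.toMonad.μ.app carrier ≫ str ≈₂ T.toMonad.map str ≫ str

/-- A homomorphism of algebras. -/
structure AlgHom {T : TwoMonad C} (A B : Alg T) where
  hom : A.carrier ⟶ B.carrier
  comm : A.str ≫ hom ≈₂ T.toMonad.map hom ≫ B.str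

/-- The Eilenberg-Moore category of algebras. -/
instance (T : TwoMonad C) : Category (Alg T) where
  Hom := AlgHom
  id A := ⟨𝟙 _, by simp⟩
  comp {A B D} f g := ⟨f.hom ≫ g.hom, by
    have h1 : A.str ≫ f.hom ≫ g.hom ≈₂ T.toMonad.map f.hom ≫ B.str ≫ g.hom := by
      constructor
      · simpa using LocallyOrdered.comp_le_comp f.comm.1 (le_refl g.hom)
      · simpa using LocallyOrdered.comp_le_comp f.comm.2 (le_refl g.hom)
    have h2 : T.toMonad.map f.hom ≫ B.str ≫ g.hom ≈₂
        T.toMonad.map (f.hom ≫ g.hom) ≫ D.str := by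
      constructor
      · simpa using LocallyOrdered.comp_le_comp (le_refl (T.toMonad.map f.hom)) g.comm.1
      · simpa using LocallyOrdered.comp_le_comp (le_refl (T.toMonad.map f.hom)) g.comm.2
    exact ⟨h1.1.trans h2.1, h2.2.trans h1.2⟩⟩

/-- The local order on algebras is that of the underlying arrows. -/
instance (T : TwoMonad C) : LocallyOrdered (Alg T) where
  homPreorder A B := Preorder.lift (AlgHom.hom : AlgHom A B → (A.carrier ⟶ B.carrier))
  comp_le_comp h h' := LocallyOrdered.comp_le_comp (C := C) h h'

/-- The forgetful 2-functor from algebras to the base. -/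
def Alg.forget (T : TwoMonad C) : TwoFunctor (Alg T) C where
  obj A := A.carrier
  map f := AlgHom.hom f
  map_id _ := rfl
  map_comp _ _ := rfl
  map_mono h := h

end Algebras

end LocallyOrdered

section Quantaloids

/-! ### Quantaloids, split-idempotent completion, modules -/

/-- A quantaloid: a category enriched in complete lattices and supremum-preserving maps. -/
class Quantaloid (Q : Type u) [Category.{v} Q] where
  homLattice (X Y : Q) : CompleteLattice (X ⟶ Y)
  sSup_comp {X Y Z : Q} (S : Set (X ⟶ Y)) (g : Y ⟶ Z) :
    IsLUB ((fun f => f ≫ g) '' S) (sSup S ≫ g)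
  comp_sSup {X Y Z : Q} (f : X ⟶ Y) (S : Set (Y ⟶ Z)) :
    IsLUB ((fun g => f ≫ g) '' S) (f ≫ sSup S)

attribute [reducible, instance] Quantaloid.homLattice

section Basic

variable {Q : Type u} [Category.{v} Q] [Quantaloid Q]

theorem iSup_comp {X Y Z : Q} {ι : Sort w} (f : ι → (X ⟶ Y)) (g : Y ⟶ Z) :
    (⨆ i, f i) ≫ g = ⨆ i, f i ≫ g := by
  have h := (Quantaloid.sSup_comp (Set.range f) g).sSup_eq
  rw [← Set.range_comp] at h
  exact h.symm

theorem comp_iSup {X Y Z : Q} {ι : Sort w} (f : X ⟶ Y) (g : ι → (Y ⟶ Z)) :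
    f ≫ (⨆ i, g i) = ⨆ i, f ≫ g i := by
  have h := (Quantaloid.comp_sSup f (Set.range g)).sSup_eq
  rw [← Set.range_comp] at h
  exact h.symm

theorem comp_mono {X Y Z : Q} {f f' : X ⟶ Y} {g g' : Y ⟶ Z} (hf : f ≤ f') (hg : g ≤ g') :
    f ≫ g ≤ f' ≫ g' := by
  have h1 : f ≫ g ≤ f' ≫ g := by
    have h := (Quantaloid.sSup_comp {f, f'} g).1 ⟨f, by simp, rfl⟩
    rwa [sSup_pair, sup_eq_right.2 hf] at h
  have h2 : f' ≫ g ≤ f' ≫ g' := by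
    have h := (Quantaloid.comp_sSup f' {g, g'}).1 ⟨g, by simp, rfl⟩
    rwa [sSup_pair, sup_eq_right.2 hg] at h
  exact h1.trans h2

end Basic

/-- A quantaloid is in particular a locally ordered category. -/
@[reducible] def Quantaloid.locallyOrdered (Q : Type u) [Category.{v} Q] [Quantaloid Q] :
    LocallyOrdered Q where
  homPreorder _ _ := inferInstance
  comp_le_comp := comp_mono

/-- The opposite quantaloid. -/
instance (Q : Type u) [Category.{v} Q] [Quantaloid Q] : Quantaloid Qᵒᵖ where
  homLattice X Y :=
    letI : PartialOrder (X ⟶ Y) :=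
      PartialOrder.lift (fun f : X ⟶ Y => f.unop) Quiver.Hom.unop_inj
    letI : SupSet (X ⟶ Y) := ⟨fun S => (⨆ f : S, f.1.unop).op⟩
    completeLatticeOfSup (X ⟶ Y) fun S =>
      ⟨fun f hf => le_iSup (fun f : S => f.1.unop) ⟨f, hf⟩,
        fun _ hg => iSup_le fun f => hg f.2⟩
  sSup_comp {X Y Z} S g := by
    have h : g.unop ≫ (⨆ f : S, f.1.unop) = ⨆ f : S, g.unop ≫ f.1.unop := comp_iSup _ _
    constructor
    · rintro _ ⟨f, hf, rfl⟩
      exact (le_iSup (fun f : S => g.unop ≫ f.1.unop) ⟨f, hf⟩).trans h.ge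
    · exact fun k hk => h.le.trans (iSup_le fun f => hk ⟨f.1, f.2, rfl⟩)
  comp_sSup {X Y Z} f S := by
    have h : (⨆ g : S, g.1.unop) ≫ f.unop = ⨆ g : S, g.1.unop ≫ f.unop := iSup_comp _ _
    constructor
    · rintro _ ⟨g, hg, rfl⟩
      exact (le_iSup (fun g : S => g.1.unop ≫ f.unop) ⟨g, hg⟩).trans h.ge
    · exact fun k hk => h.le.trans (iSup_le fun g => hk ⟨g.1, g.2, rfl⟩)

/-- The quantaloid `Idm(Q)`, on Mathlib's category of idempotents in `Q`: its objects are the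
idempotents `e`, its arrows `e ⟶ f` the arrows `b` with `e ≫ b = b = b ≫ f`, and the identity on
`e` is `e`; the local order is that of `Q`. -/
instance (Q : Type u) [Category.{v} Q] [Quantaloid Q] : Quantaloid (Idempotents.Karoubi Q) where
  homLattice X Y :=
    letI : PartialOrder (X ⟶ Y) :=
      PartialOrder.lift (fun f : X ⟶ Y => f.f) fun f g h => Idempotents.Karoubi.Hom.ext h
    letI : SupSet (X ⟶ Y) := ⟨fun S => ⟨⨆ f : S, f.1.f, by
      simp only [iSup_comp, comp_iSup, Idempotents.Karoubi.Hom.comm]⟩⟩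
    completeLatticeOfSup (X ⟶ Y) fun S =>
      ⟨fun f hf => le_iSup (fun f : S => f.1.f) ⟨f, hf⟩,
        fun _ hg => iSup_le fun f => hg f.2⟩
  sSup_comp {X Y Z} S g := by
    have h : (⨆ f : S, f.1.f) ≫ g.f = ⨆ f : S, f.1.f ≫ g.f := iSup_comp _ _
    constructor
    · rintro _ ⟨f, hf, rfl⟩
      exact (le_iSup (fun f : S => f.1.f ≫ g.f) ⟨f, hf⟩).trans h.ge
    · exact fun k hk => h.le.trans (iSup_le fun f => hk ⟨f.1, f.2, rfl⟩)
  comp_sSup {X Y Z} f S := by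
    have h : f.f ≫ (⨆ g : S, g.1.f) = ⨆ g : S, f.f ≫ g.1.f := comp_iSup _ _
    constructor
    · rintro _ ⟨g, hg, rfl⟩
      exact (le_iSup (fun g : S => f.f ≫ g.1.f) ⟨g, hg⟩).trans h.ge
    · exact fun k hk => h.le.trans (iSup_le fun g => hk ⟨g.1, g.2, rfl⟩)

/-- The objects of `Sup`: complete lattices. -/
structure SupLat : Type (u + 1) where
  carrier : Type u
  [lattice : CompleteLattice carrier]

attribute [instance] SupLat.lattice

/-- The category `Sup` of complete lattices and supremum-preserving maps. -/
instance : Category SupLat.{u} where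
  Hom X Y := sSupHom X.carrier Y.carrier
  id X := sSupHom.id X.carrier
  comp f g := sSupHom.comp g f

/-- The map underlying an arrow of `Sup`. -/
abbrev SupLat.fn {X Y : SupLat.{u}} (f : X ⟶ Y) : X.carrier → Y.carrier := sSupHom.toFun f

theorem SupLat.fn_sSup {X Y : SupLat.{u}} (f : X ⟶ Y) (s : Set X.carrier) :
    SupLat.fn f (sSup s) = ⨆ x : s, SupLat.fn f x.1 := by
  rw [iSup, ← Set.image_eq_range]
  exact sSupHom.map_sSup' f s

theorem SupLat.fn_iSup {X Y : SupLat.{u}} (f : X ⟶ Y) {ι : Sort w} (x : ι → X.carrier) :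
    SupLat.fn f (⨆ i, x i) = ⨆ i, SupLat.fn f (x i) := by
  have h := sSupHom.map_sSup' f (Set.range x)
  rw [← Set.range_comp] at h
  exact h

/-- `Sup` is a quantaloid under the pointwise order. -/
instance : Quantaloid SupLat.{u} where
  homLattice X Y :=
    letI : PartialOrder (X ⟶ Y) :=
      inferInstanceAs (PartialOrder (sSupHom X.carrier Y.carrier))
    letI : SupSet (X ⟶ Y) := ⟨fun S =>
      { toFun := fun x => ⨆ f : S, SupLat.fn f.1 x
        map_sSup' := fun s => by
          simp only [SupLat.fn_sSup]
          rw [iSup_comm, sSup_image']  }⟩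
    completeLatticeOfSup (X ⟶ Y) fun S =>
      ⟨fun f hf x => le_iSup (fun f : S => SupLat.fn f.1 x) ⟨f, hf⟩,
        fun _ hg x => iSup_le fun f => hg f.2 x⟩
  sSup_comp {X Y Z} S g := by
    have h (x : X.carrier) : SupLat.fn g (⨆ f : S, SupLat.fn f.1 x) =
        ⨆ f : S, SupLat.fn g (SupLat.fn f.1 x) := SupLat.fn_iSup g _
    constructor
    · rintro _ ⟨f, hf, rfl⟩ x
      exact (le_iSup (fun f : S => SupLat.fn g (SupLat.fn f.1 x)) ⟨f, hf⟩).trans (h x).ge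
    · exact fun k hk x => (h x).le.trans (iSup_le fun f => hk ⟨f.1, f.2, rfl⟩ x)
  comp_sSup {X Y Z} f S :=
    ⟨by
      rintro _ ⟨g, hg, rfl⟩ x
      exact le_iSup (fun g : S => SupLat.fn g.1 (SupLat.fn f x)) ⟨g, hg⟩,
    fun k hk x => iSup_le fun g => hk ⟨g.1, g.2, rfl⟩ x⟩

/-- A homomorphism of quantaloids: a functor preserving suprema of parallel arrows. -/
structure QuantHom (Q : Type u) [Category.{v} Q] [Quantaloid Q]
    (R : Type u') [Category.{v'} R] [Quantaloid R] where
  functor : Q ⥤ R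
  map_sSup {X Y : Q} (S : Set (X ⟶ Y)) :
    functor.map (sSup S) = sSup ((fun f => functor.map f) '' S)

/-- `QUANT(Q, R)`: homomorphisms and natural transformations. -/
instance (Q : Type u) [Category.{v} Q] [Quantaloid Q]
    (R : Type u') [Category.{v'} R] [Quantaloid R] : Category (QuantHom Q R) where
  Hom F G := NatTrans F.functor G.functor
  id F := NatTrans.id F.functor
  comp α β := NatTrans.vcomp α β

/-- `QUANT(Q, R)` is a quantaloid: natural transformations are ordered componentwise. -/
instance (Q : Type u) [Category.{v} Q] [Quantaloid Q]
    (R : Type u') [Category.{v'} R] [Quantaloid R] : Quantaloid (QuantHom Q R) where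
  homLattice F G :=
    letI : PartialOrder (F ⟶ G) :=
      PartialOrder.lift (fun α : F ⟶ G => NatTrans.app α) fun _ _ h => NatTrans.ext h
    letI : SupSet (F ⟶ G) := ⟨fun S => NatTrans.mk (fun X => ⨆ α : S, NatTrans.app α.1 X)
      (fun X Y f => by simp only [iSup_comp, comp_iSup, NatTrans.naturality])⟩
    completeLatticeOfSup (F ⟶ G) fun S =>
      ⟨fun α hα X => le_iSup (fun α : S => NatTrans.app α.1 X) ⟨α, hα⟩,
        fun _ hg X => iSup_le fun α => hg α.2 X⟩
  sSup_comp {F G H} S β := by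
    have h (X : Q) : (⨆ α : S, NatTrans.app α.1 X) ≫ NatTrans.app β X =
        ⨆ α : S, NatTrans.app α.1 X ≫ NatTrans.app β X := iSup_comp _ _
    constructor
    · rintro _ ⟨α, hα, rfl⟩ X
      exact (le_iSup (fun α : S => NatTrans.app α.1 X ≫ NatTrans.app β X) ⟨α, hα⟩).trans (h X).ge
    · exact fun k hk X => (h X).le.trans (iSup_le fun α => hk ⟨α.1, α.2, rfl⟩ X)
  comp_sSup {F G H} α S := by
    have h (X : Q) : NatTrans.app α X ≫ (⨆ β : S, NatTrans.app β.1 X) =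
        ⨆ β : S, NatTrans.app α X ≫ NatTrans.app β.1 X := comp_iSup _ _
    constructor
    · rintro _ ⟨β, hβ, rfl⟩ X
      exact (le_iSup (fun β : S => NatTrans.app α X ≫ NatTrans.app β.1 X) ⟨β, hβ⟩).trans (h X).ge
    · exact fun k hk X => (h X).le.trans (iSup_le fun β => hk ⟨β.1, β.2, rfl⟩ X)

/-- `Mod(Q) = QUANT(Qᵒᵖ, Sup)`, the quantaloid of modules on `Q`. -/
abbrev QMod (Q : Type u) [Category.{u} Q] [Quantaloid Q] := QuantHom Qᵒᵖ SupLat.{u}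

instance (Q : Type u) [Category.{u} Q] [Quantaloid Q] : LocallyOrdered (QMod Q) :=
  Quantaloid.locallyOrdered (QMod Q)

end Quantaloids

section Enriched

/-! ### Categories, functors and distributors enriched in a small quantaloid -/

/-- A category enriched in the quantaloid `R`. The set of objects with its type function is given
by its fibres: `Ob X` is the set of objects of type `X`. For `a` of type `X` and `a'` of type `Y`,
`hom a' a : X ⟶ Y` is the hom-arrow from `a'` to `a`. -/
structure QCat (R : Type u) [Category.{u} R] [Quantaloid R] where
  Ob : R → Type u
  hom {X Y : R} (a' : Ob Y) (a : Ob X) : X ⟶ Y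
  hom_comp_le {X Y Z : R} (a : Ob X) (a' : Ob Y) (a'' : Ob Z) :
    hom a' a ≫ hom a'' a' ≤ hom a'' a
  id_le {X : R} (a : Ob X) : 𝟙 X ≤ hom a a

variable {R : Type u} [Category.{u} R] [Quantaloid R]

/-- A functor between enriched categories: a type-preserving map on objects which is
increasing on hom-arrows. -/
@[ext]
structure QFunctor (A B : QCat R) where
  obj {X : R} : A.Ob X → B.Ob X
  hom_le {X Y : R} (a' : A.Ob Y) (a : A.Ob X) : A.hom a' a ≤ B.hom (obj a') (obj a)

/-- `Cat(R)`: enriched categories and functors. -/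
instance : Category (QCat R) where
  Hom := QFunctor
  id A := ⟨fun a => a, fun _ _ => le_rfl⟩
  comp F G := ⟨fun a => G.obj (F.obj a), fun a' a => (F.hom_le a' a).trans (G.hom_le _ _)⟩

/-- Parallel functors are ordered by `F ≤ G` iff `1 ≤ B(F a, G a)` for all `a`. -/
instance (A B : QCat R) : Preorder (A ⟶ B) where
  le F G := ∀ (X : R) (a : A.Ob X), 𝟙 X ≤ B.hom (QFunctor.obj F a) (QFunctor.obj G a)
  le_refl _ _ _ := B.id_le _
  le_trans F G H h h' X a := by
    have := comp_mono (h' X a) (h X a)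
    rw [Category.id_comp] at this
    exact this.trans (B.hom_comp_le _ _ _)

/-- `Cat(R)` is a locally ordered category. -/
instance : LocallyOrdered (QCat R) where
  homPreorder _ _ := inferInstance
  comp_le_comp {A B C F F' G G'} h h' X a := by
    have := comp_mono (h' X (QFunctor.obj F' a)) ((h X a).trans (QFunctor.hom_le G _ _))
    rw [Category.id_comp] at this
    exact this.trans (C.hom_comp_le _ _ _)

/-- A distributor from `A` to `B`: arrows `elt b a : X ⟶ Y` for `a` of type `X` and `b` of
type `Y`, with an action of the hom-arrows of `B` and of `A`. -/
structure Dist (A B : QCat R) where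
  elt {X Y : R} (b : B.Ob Y) (a : A.Ob X) : X ⟶ Y
  elt_hom_le {X Y Z : R} (a : A.Ob X) (b' : B.Ob Y) (b : B.Ob Z) :
    elt b' a ≫ B.hom b b' ≤ elt b a
  hom_elt_le {X Y Z : R} (a : A.Ob X) (a' : A.Ob Y) (b : B.Ob Z) :
    A.hom a' a ≫ elt b a' ≤ elt b a

/-- Distributors are ordered elementwise. -/
instance (A B : QCat R) : LE (Dist A B) where
  le Φ Ψ := ∀ {X Y : R} (b : B.Ob Y) (a : A.Ob X), Φ.elt b a ≤ Ψ.elt b a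

/-- The composite `Ψ ⊗ Φ`, with elements `⋁ b, Ψ(c,b) ∘ Φ(b,a)`. -/
def Dist.comp {A B C : QCat R} (Φ : Dist A B) (Ψ : Dist B C) : Dist A C where
  elt c a := ⨆ (Y : R) (b : B.Ob Y), Φ.elt b a ≫ Ψ.elt c b
  elt_hom_le a c' c := by
    simp only [iSup_comp, Category.assoc]
    exact iSup₂_mono fun Y b => comp_mono le_rfl (Ψ.elt_hom_le _ _ _)
  hom_elt_le a a' c := by
    simp only [comp_iSup, ← Category.assoc]
    exact iSup₂_mono fun Y b => comp_mono (Φ.hom_elt_le _ _ _) le_rfl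

/-- The identity distributor. -/
def Dist.id (A : QCat R) : Dist A A where
  elt a' a := A.hom a' a
  elt_hom_le _ _ _ := A.hom_comp_le _ _ _
  hom_elt_le _ _ _ := A.hom_comp_le _ _ _

/-- A left adjoint (or Cauchy) distributor. -/
def Dist.IsLeftAdjoint {A B : QCat R} (Φ : Dist A B) : Prop :=
  ∃ Ψ : Dist B A, Dist.id A ≤ Φ.comp Ψ ∧ Ψ.comp Φ ≤ Dist.id B

/-- The distributor `B(-, F-) : A ⇸ B` represented by a functor `F : A ⟶ B`. -/
def QFunctor.lower {A B : QCat R} (F : QFunctor A B) : Dist A B where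
  elt b a := B.hom b (F.obj a)
  elt_hom_le _ _ _ := B.hom_comp_le _ _ _
  hom_elt_le _ _ _ := (comp_mono (F.hom_le _ _) le_rfl).trans (B.hom_comp_le _ _ _)

/-- The distributor `B(F-, -) : B ⇸ A` represented by a functor `F : A ⟶ B`. -/
def QFunctor.upper {A B : QCat R} (F : QFunctor A B) : Dist B A where
  elt a b := B.hom (F.obj a) b
  elt_hom_le _ _ _ := (comp_mono le_rfl (F.hom_le _ _)).trans (B.hom_comp_le _ _ _)
  hom_elt_le _ _ _ := B.hom_comp_le _ _ _

/-- `K : A ⟶ C` is the `Φ`-weighted colimit of `F : B ⟶ C`, for a distributor `Φ : A ⇸ B`, when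
`C(K-, -) = [Φ, C(F-, -)]`. Here `[Φ, -]` is right adjoint to `Φ ⊗ -`; that is, `[Φ, Θ]` is
the greatest `Ψ` with `Φ ⊗ Ψ ≤ Θ`. -/
def IsWeightedColimit {A B C : QCat R} (Φ : Dist A B) (F : B ⟶ C) (K : A ⟶ C) : Prop :=
  IsGreatest {Ψ : Dist C A | Ψ.comp Φ ≤ QFunctor.upper F} (QFunctor.upper K)

/-- A functor is cocontinuous when it preserves all weighted colimits that exist in its domain. -/
def IsCocontinuous {C D : QCat R} (G : C ⟶ D) : Prop :=
  ∀ (A B : QCat R) (Φ : Dist A B) (F : B ⟶ C) (K : A ⟶ C),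
    IsWeightedColimit Φ F K → IsWeightedColimit Φ (F ≫ G) (K ≫ G)

/-- An enriched category is cocomplete when it admits all weighted colimits. -/
def IsCocomplete (C : QCat R) : Prop :=
  ∀ (A B : QCat R) (Φ : Dist A B) (F : B ⟶ C), ∃ K : A ⟶ C, IsWeightedColimit Φ F K

/-- `C` is Cauchy complete when every left adjoint distributor into `C` is represented by
a functor. -/
def IsCauchyComplete (C : QCat R) : Prop :=
  ∀ (A : QCat R) (Φ : Dist A C), Φ.IsLeftAdjoint → ∃ F : A ⟶ C, QFunctor.lower F = Φ

theorem Dist.ext' {A B : QCat R} {Φ Ψ : Dist A B} (h : Φ ≤ Ψ) (h' : Ψ ≤ Φ) : Φ = Ψ := by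
  obtain ⟨φ, _, _⟩ := Φ
  obtain ⟨ψ, _, _⟩ := Ψ
  have : @φ = @ψ := by
    funext X Y b a
    exact le_antisymm (h b a) (h' b a)
  subst this
  rfl

theorem IsCocomplete.isCauchyComplete {C : QCat R} (hC : IsCocomplete C) :
    IsCauchyComplete C := by
  rintro A Φ ⟨Ψ, hη, hε⟩
  obtain ⟨K, hK, hK'⟩ := hC A C Φ (𝟙 C)
  have h1 : Ψ ≤ QFunctor.upper K := hK' (fun a c => hε a c)
  have h2 {X Y Z : R} (a : A.Ob X) (c : C.Ob Y) (c' : C.Ob Z) :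
      C.hom (QFunctor.obj K a) c ≫ Φ.elt c' a ≤ C.hom c' c :=
    le_trans (le_iSup₂ (f := fun (X : R) (a : A.Ob X) =>
      C.hom (QFunctor.obj K a) c ≫ Φ.elt c' a) X a) (hK c' c)
  refine ⟨K, Dist.ext' ?_ ?_⟩
  · intro X Y c a
    have h3 := comp_mono (hη a a) (le_refl (C.hom c (QFunctor.obj K a)))
    have h4 : 𝟙 X ≫ C.hom c (QFunctor.obj K a) ≤ _ :=
      (comp_mono (A.id_le a) le_rfl).trans h3
    rw [Category.id_comp] at h4
    refine h4.trans ?_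
    change (⨆ (Y : R) (b : C.Ob Y), Φ.elt b a ≫ Ψ.elt a b) ≫ _ ≤ _
    simp only [iSup_comp, Category.assoc]
    refine iSup₂_le fun Z c' => ?_
    refine le_trans (comp_mono le_rfl ?_) (Φ.elt_hom_le a c' c)
    exact (comp_mono (h1 a c') le_rfl).trans (C.hom_comp_le _ _ _)
  · intro X Y c a
    have h3 := comp_mono (C.id_le (QFunctor.obj K a)) (le_refl (Φ.elt c a))
    rw [Category.id_comp] at h3
    exact h3.trans (h2 a _ c)

/-- A left adjoint functor is cocontinuous. -/
theorem isCocontinuous_of_adjoint {C D : QCat R} (L : C ⟶ D) (G : D ⟶ C)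
    (h : ∀ {X Y : R} (c : C.Ob Y) (d : D.Ob X),
      D.hom (QFunctor.obj L c) d = C.hom c (QFunctor.obj G d)) : IsCocontinuous L := by
  intro A B Φ F K hK
  constructor
  · intro X Y b d
    change (⨆ (Z : R) (a : A.Ob Z), D.hom (QFunctor.obj L (QFunctor.obj K a)) d ≫ Φ.elt b a) ≤
      D.hom (QFunctor.obj L (QFunctor.obj F b)) d
    simp only [h]
    exact hK.1 b (QFunctor.obj G d)
  · intro Ψ hΨ X Y a d
    have key : Dist.comp (QFunctor.upper G) Ψ ≤
        QFunctor.upper K := by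
      refine hK.2 ?_
      intro X Y b c
      change (⨆ (Z : R) (a : A.Ob Z), (⨆ (W : R) (d : D.Ob W),
        C.hom (QFunctor.obj G d) c ≫ Ψ.elt a d) ≫ Φ.elt b a) ≤ C.hom (QFunctor.obj F b) c
      simp only [iSup_comp, Category.assoc]
      refine iSup₂_le fun Z a => iSup₂_le fun W d => ?_
      have h1 : Ψ.elt a d ≫ Φ.elt b a ≤ C.hom (QFunctor.obj F b) (QFunctor.obj G d) := by
        rw [← h]
        exact le_trans (le_iSup₂ (f := fun (Z : R) (a : A.Ob Z) => Ψ.elt a d ≫ Φ.elt b a) Z a)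
          (hΨ b d)
      exact (comp_mono le_rfl h1).trans (C.hom_comp_le _ _ _)
    have h2 := comp_mono (C.id_le (QFunctor.obj G d)) (le_refl (Ψ.elt a d))
    rw [Category.id_comp] at h2
    have h3 := key a (QFunctor.obj G d)
    refine h2.trans (le_trans ?_ (h3.trans (h _ _).ge))
    exact le_iSup₂ (f := fun (W : R) (d' : D.Ob W) =>
      C.hom (QFunctor.obj G d') (QFunctor.obj G d) ≫ Ψ.elt a d') X d

variable (R) in
/-- `Cat_cc(R)`: the full subcategory of `Cat(R)` on the Cauchy complete categories. -/
structure CatCC where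
  toQCat : QCat R
  cauchy : IsCauchyComplete toQCat

instance : Category (CatCC R) where
  Hom A B := A.toQCat ⟶ B.toQCat
  id A := 𝟙 A.toQCat
  comp {A B C} (F : A.toQCat ⟶ B.toQCat) (G : B.toQCat ⟶ C.toQCat) := F ≫ G

instance : LocallyOrdered (CatCC R) where
  homPreorder A B := inferInstanceAs (Preorder (A.toQCat ⟶ B.toQCat))
  comp_le_comp h h' := LocallyOrdered.comp_le_comp (C := QCat R) h h'

variable (R) in
/-- `Cocont(R)`: the subcategory of `Cat(R)` of cocomplete categories and cocontinuous functors. -/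
structure Cocont where
  toQCat : QCat R
  cocomplete : IsCocomplete toQCat

instance : Category (Cocont R) where
  Hom A B := {F : A.toQCat ⟶ B.toQCat // IsCocontinuous F}
  id A := ⟨𝟙 A.toQCat, fun _ _ _ _ _ h => h⟩
  comp F G := ⟨F.1 ≫ G.1, fun _ _ _ _ _ h => G.2 _ _ _ _ _ (F.2 _ _ _ _ _ h)⟩

instance : LocallyOrdered (Cocont R) where
  homPreorder A B := inferInstanceAs
    (Preorder {F : A.toQCat ⟶ B.toQCat // IsCocontinuous F})
  comp_le_comp h h' := LocallyOrdered.comp_le_comp (C := QCat R) h h'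

variable (R) in
/-- The forgetful 2-functor `U : Cocont(R) ⟶ Cat_cc(R)`. -/
def forgetCocont : TwoFunctor (Cocont R) (CatCC R) where
  obj A := ⟨A.toQCat, A.cocomplete.isCauchyComplete⟩
  map F := F.1
  map_id _ := rfl
  map_comp _ _ := rfl
  map_mono h := h

/-! ### The presheaf construction -/

/-- A presheaf of type `X` on `A`: a distributor `*_X ⇸ A`, where `*_X` is the category with one
object, of type `X`, and hom-arrow `1_X`. -/
@[ext]
structure Presheaf (A : QCat R) (X : R) where
  elt {Y : R} (a : A.Ob Y) : X ⟶ Y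
  elt_hom_le {Y Z : R} (a' : A.Ob Y) (a : A.Ob Z) : elt a' ≫ A.hom a a' ≤ elt a

/-- The category `P A` of presheaves on `A`: its hom-arrow `P A (ψ, φ)` is `[ψ, φ]`, the greatest
arrow `f` with `ψ ∘ f ≤ φ`. -/
def psh (A : QCat R) : QCat R where
  Ob X := Presheaf A X
  hom {X Y} ψ φ := sSup {f : X ⟶ Y | ∀ (Z : R) (a : A.Ob Z), f ≫ ψ.elt a ≤ φ.elt a}
  hom_comp_le {X Y Z} φ φ' φ'' := by
    simp only [sSup_eq_iSup', iSup_comp, comp_iSup]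
    refine iSup_le fun g => iSup_le fun f => le_iSup_of_le ⟨f.1 ≫ g.1, fun W a => ?_⟩ le_rfl
    rw [Category.assoc]
    exact (comp_mono le_rfl (g.2 W a)).trans (f.2 W a)
  id_le φ := le_sSup fun Z a => by rw [Category.id_comp]

theorem psh_hom_comp_le {A : QCat R} {X Y Z : R} (ψ : Presheaf A Y) (φ : Presheaf A X)
    (a : A.Ob Z) : (psh A).hom ψ φ ≫ ψ.elt a ≤ φ.elt a := by
  simp only [psh, sSup_eq_iSup', iSup_comp]
  exact iSup_le fun f => f.2 Z a

theorem le_psh_hom {A : QCat R} {X Y : R} {ψ : Presheaf A Y} {φ : Presheaf A X} {f : X ⟶ Y}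
    (h : ∀ (Z : R) (a : A.Ob Z), f ≫ ψ.elt a ≤ φ.elt a) : f ≤ (psh A).hom ψ φ :=
  le_sSup h

theorem psh_isCocomplete (A : QCat R) : IsCocomplete (psh A) := by
  intro D E Φ F
  let K : D ⟶ psh A := QFunctor.mk
    (fun {X} d =>
      { elt := fun a => ⨆ (Y : R) (e : E.Ob Y), Φ.elt e d ≫ (QFunctor.obj F e).elt a
        elt_hom_le := fun a' a => by
          simp only [iSup_comp, Category.assoc]
          exact iSup₂_mono fun Y e => comp_mono le_rfl ((QFunctor.obj F e).elt_hom_le _ _) })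
    (fun d' d => le_psh_hom fun Z a => by
      simp only [comp_iSup, ← Category.assoc]
      exact iSup₂_mono fun Y e => comp_mono (Φ.hom_elt_le _ _ _) le_rfl)
  refine ⟨K, ?_, ?_⟩
  · intro X Y e ψ
    refine iSup₂_le fun Z d => le_psh_hom fun W a => ?_
    rw [Category.assoc]
    refine le_trans (comp_mono le_rfl ?_) (psh_hom_comp_le (QFunctor.obj K d) ψ a)
    exact le_iSup₂ (f := fun (Y : R) (e : E.Ob Y) => Φ.elt e d ≫ (QFunctor.obj F e).elt a) Y e
  · intro Ψ hΨ X Y d ψ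
    refine le_psh_hom fun Z a => ?_
    change Ψ.elt d ψ ≫ (⨆ (Y : R) (e : E.Ob Y), Φ.elt e d ≫ (QFunctor.obj F e).elt a) ≤ _
    simp only [comp_iSup, ← Category.assoc]
    refine iSup₂_le fun W e => ?_
    refine le_trans (comp_mono ?_ le_rfl) (psh_hom_comp_le (QFunctor.obj F e) ψ a)
    exact le_trans (le_iSup₂ (f := fun (Y : R) (d : D.Ob Y) => Ψ.elt d ψ ≫ Φ.elt e d) Y d)
      (hΨ e ψ)

/-- `P F : P A ⟶ P B` sends a presheaf `φ` to `B(-, F-) ⊗ φ`. -/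
def pshMap {A B : QCat R} (F : A ⟶ B) : psh A ⟶ psh B := QFunctor.mk
  (fun φ : Presheaf A _ =>
    { elt := fun b => ⨆ (Y : R) (a : A.Ob Y), φ.elt a ≫ B.hom b (QFunctor.obj F a)
      elt_hom_le := fun b' b => by
        simp only [iSup_comp, Category.assoc]
        exact iSup₂_mono fun Y e => comp_mono le_rfl (B.hom_comp_le _ _ _) })
  (fun ψ φ => le_psh_hom fun Z b => by
    simp only [comp_iSup, ← Category.assoc]
    exact iSup₂_mono fun Y a => comp_mono (psh_hom_comp_le _ _ _) le_rfl)

theorem psh_ext {A : QCat R} {X : R} {φ ψ : Presheaf A X}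
    (h : ∀ (Y : R) (a : A.Ob Y), φ.elt a = ψ.elt a) : φ = ψ := by
  ext Y a
  exact h Y a

theorem pshFunctor_ext {A B : QCat R} {F G : A ⟶ psh B}
    (h : ∀ (X : R) (a : A.Ob X) (Y : R) (b : B.Ob Y),
      (QFunctor.obj F a : Presheaf B X).elt b = (QFunctor.obj G a : Presheaf B X).elt b) :
    F = G := by
  apply QFunctor.ext
  funext X a
  exact psh_ext (h X a)

theorem pshMap_isCocontinuous {A B : QCat R} (F : A ⟶ B) : IsCocontinuous (pshMap F) := by
  let G : psh B ⟶ psh A := QFunctor.mk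
    (fun ψ : Presheaf B _ =>
      { elt := fun a => ψ.elt (QFunctor.obj F a)
        elt_hom_le := fun a' a =>
          (comp_mono le_rfl (QFunctor.hom_le F _ _)).trans (ψ.elt_hom_le _ _) })
    (fun ψ φ => le_psh_hom fun Z a => psh_hom_comp_le ψ φ (QFunctor.obj F a))
  refine isCocontinuous_of_adjoint (pshMap F) G fun {X Y} φ ψ => le_antisymm ?_ ?_
  · refine le_psh_hom fun Z a => ?_
    refine le_trans (comp_mono le_rfl ?_) (psh_hom_comp_le (QFunctor.obj (pshMap F) φ) ψ
      (QFunctor.obj F a))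
    refine le_trans ?_ (le_iSup₂ (f := fun (Y : R) (a' : A.Ob Y) =>
      Presheaf.elt φ a' ≫ B.hom (QFunctor.obj F a) (QFunctor.obj F a')) Z a)
    have := comp_mono (le_refl (Presheaf.elt φ a)) (B.id_le (QFunctor.obj F a))
    rwa [Category.comp_id] at this
  · refine le_psh_hom fun Z b => ?_
    change _ ≫ (⨆ (Y : R) (a : A.Ob Y), Presheaf.elt φ a ≫ B.hom b (QFunctor.obj F a)) ≤ _
    simp only [comp_iSup, ← Category.assoc]
    refine iSup₂_le fun W a => ?_
    exact le_trans (comp_mono (psh_hom_comp_le φ (QFunctor.obj G ψ) a) le_rfl)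
      (Presheaf.elt_hom_le ψ _ _)

theorem iSup_elt_hom {A : QCat R} {X Y : R} (φ : Presheaf A X) (b : A.Ob Y) :
    ⨆ (Z : R) (a : A.Ob Z), φ.elt a ≫ A.hom b a = φ.elt b := by
  refine le_antisymm (iSup₂_le fun Z a => φ.elt_hom_le a b) ?_
  refine le_trans ?_ (le_iSup₂ (f := fun (Z : R) (a : A.Ob Z) => φ.elt a ≫ A.hom b a) Y b)
  have := comp_mono (le_refl (φ.elt b)) (A.id_le b)
  rwa [Category.comp_id] at this

theorem iSup_hom_hom {A : QCat R} {X Y : R} (a : A.Ob X) (b : A.Ob Y) :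
    ⨆ (Z : R) (c : A.Ob Z), A.hom c a ≫ A.hom b c = A.hom b a :=
  iSup_elt_hom ⟨fun c => A.hom c a, fun _ _ => A.hom_comp_le _ _ _⟩ b

theorem iSup_hom_elt {A : QCat R} {X Y : R} (φ : Presheaf A X) (b : A.Ob Y) :
    ⨆ (Z : R) (ψ : Presheaf A Z), (psh A).hom ψ φ ≫ ψ.elt b = φ.elt b := by
  refine le_antisymm (iSup₂_le fun Z ψ => psh_hom_comp_le ψ φ b) ?_
  refine le_trans ?_ (le_iSup₂ (f := fun (Z : R) (ψ : Presheaf A Z) =>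
    (psh A).hom ψ φ ≫ ψ.elt b) X φ)
  have := comp_mono ((psh A).id_le φ) (le_refl (φ.elt b))
  rwa [Category.id_comp] at this

theorem pshMap_id (A : QCat R) : pshMap (𝟙 A) = 𝟙 (psh A) :=
  pshFunctor_ext fun _ φ _ b => iSup_elt_hom (A := A) φ b

theorem pshMap_comp {A B C : QCat R} (F : A ⟶ B) (G : B ⟶ C) :
    pshMap (F ≫ G) = pshMap F ≫ pshMap G := by
  refine pshFunctor_ext fun X φ Y c => ?_
  change (⨆ (Z : R) (a : A.Ob Z), Presheaf.elt φ a ≫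
      C.hom c (QFunctor.obj G (QFunctor.obj F a))) =
    ⨆ (W : R) (b : B.Ob W), (⨆ (Z : R) (a : A.Ob Z), Presheaf.elt φ a ≫
      B.hom b (QFunctor.obj F a)) ≫ C.hom c (QFunctor.obj G b)
  refine le_antisymm (iSup₂_le fun Z a => ?_) (iSup₂_le fun W b => ?_)
  · refine le_iSup₂_of_le Z (QFunctor.obj F a) (comp_mono ?_ le_rfl)
    refine le_iSup₂_of_le Z a ?_
    have := comp_mono (le_refl (Presheaf.elt φ a)) (B.id_le (QFunctor.obj F a))
    rwa [Category.comp_id] at this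
  · simp only [iSup_comp, Category.assoc]
    refine iSup₂_mono fun Z a => comp_mono le_rfl ?_
    exact (comp_mono (QFunctor.hom_le G _ _) le_rfl).trans (C.hom_comp_le _ _ _)

theorem le_iff_psh {A B : QCat R} {F G : A ⟶ psh B} :
    F ≤ G ↔ ∀ (X : R) (a : A.Ob X) (Y : R) (b : B.Ob Y),
      (QFunctor.obj F a : Presheaf B X).elt b ≤ (QFunctor.obj G a : Presheaf B X).elt b := by
  constructor
  · intro h X a Y b
    have h1 := comp_mono (h X a) (le_refl ((QFunctor.obj F a : Presheaf B X).elt b))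
    rw [Category.id_comp] at h1
    exact h1.trans (psh_hom_comp_le _ _ b)
  · intro h X a
    refine le_psh_hom fun Y b => ?_
    rw [Category.id_comp]
    exact h X a Y b

theorem pshMap_mono {A B : QCat R} {F G : A ⟶ B} (h : F ≤ G) : pshMap F ≤ pshMap G := by
  rw [le_iff_psh]
  intro X φ Y b
  refine iSup₂_mono fun Z a => comp_mono le_rfl ?_
  have h1 := comp_mono (h Z a) (le_refl (B.hom b (QFunctor.obj F a)))
  rw [Category.id_comp] at h1
  exact h1.trans (B.hom_comp_le _ _ _)

variable (R) in
/-- The presheaf construction as a 2-functor `P : Cat_cc(R) ⟶ Cocont(R)`. -/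
def presheafFunctor : TwoFunctor (CatCC R) (Cocont R) where
  obj A := ⟨psh A.toQCat, psh_isCocomplete A.toQCat⟩
  map {A B} (F : A.toQCat ⟶ B.toQCat) := ⟨pshMap F, pshMap_isCocontinuous F⟩
  map_id A := Subtype.ext (pshMap_id A.toQCat)
  map_comp {A B C} (F : A.toQCat ⟶ B.toQCat) (G : B.toQCat ⟶ C.toQCat) :=
    Subtype.ext (pshMap_comp F G)
  map_mono h := pshMap_mono h

/-- The Yoneda embedding `A ⟶ P A`, sending `a` to the representable presheaf `A(-, a)`. -/
def yonedaQ (A : QCat R) : A ⟶ psh A := QFunctor.mk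
  (fun a => Presheaf.mk (fun x => A.hom x a) (fun _ _ => A.hom_comp_le _ _ _))
  (fun _ _ => le_psh_hom fun _ _ => A.hom_comp_le _ _ _)

variable (R) in
/-- The Yoneda embeddings as a 2-natural transformation `1 ⟹ U P` on `Cat_cc(R)`. -/
def yonedaUnit :
    𝟭 (CatCC R) ⟶ (presheafFunctor R).toFunctor ⋙ (forgetCocont R).toFunctor where
  app A := yonedaQ A.toQCat
  naturality A B F := by
    change _ ≫ yonedaQ B.toQCat = yonedaQ A.toQCat ≫ pshMap (A := A.toQCat) (B := B.toQCat) F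
    refine pshFunctor_ext fun X a Y b => ?_
    change B.toQCat.hom b (QFunctor.obj F a) = ⨆ (Z : R) (a' : A.toQCat.Ob Z),
      A.toQCat.hom a' a ≫ B.toQCat.hom b (QFunctor.obj F a')
    refine le_antisymm ?_ (iSup₂_le fun Z a' => ?_)
    · refine le_iSup₂_of_le X a ?_
      have := comp_mono (A.toQCat.id_le a) (le_refl (B.toQCat.hom b (QFunctor.obj F a)))
      rwa [Category.id_comp] at this
    · exact (comp_mono (QFunctor.hom_le F _ _) le_rfl).trans (B.toQCat.hom_comp_le _ _ _)

/-- The multiplication `P P A ⟶ P A`, sending `Θ` to the presheaf with elements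
`⋁ φ, φ(a) ∘ Θ(φ)`. -/
def pshMul (A : QCat R) : psh (psh A) ⟶ psh A := QFunctor.mk
  (fun Θ : Presheaf (psh A) _ =>
    { elt := fun a => ⨆ (Y : R) (φ : Presheaf A Y), Θ.elt (Y := Y) φ ≫ φ.elt a
      elt_hom_le := fun a' a => by
        simp only [iSup_comp, Category.assoc]
        exact iSup₂_mono fun Y φ => comp_mono le_rfl (φ.elt_hom_le _ _) })
  (fun Θ' Θ => le_psh_hom fun Z a => by
    simp only [comp_iSup, ← Category.assoc]
    exact iSup₂_mono fun Y φ => comp_mono (psh_hom_comp_le _ _ _) le_rfl)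

theorem pshMul_naturality {A B : QCat R} (F : A ⟶ B) :
    pshMap (pshMap F) ≫ pshMul B = pshMul A ≫ pshMap F := by
  refine pshFunctor_ext fun X Θ Y b => ?_
  change (⨆ (Z : R) (ψ : Presheaf B Z), (⨆ (W : R) (φ : Presheaf A W),
      Presheaf.elt (A := psh A) (X := X) Θ (Y := W) φ ≫
        (psh B).hom ψ (QFunctor.obj (pshMap F) φ)) ≫ ψ.elt b) =
    ⨆ (V : R) (a : A.Ob V), (⨆ (W : R) (φ : Presheaf A W),
      Presheaf.elt (A := psh A) (X := X) Θ (Y := W) φ ≫ φ.elt a) ≫ B.hom b (QFunctor.obj F a)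
  simp only [iSup_comp, Category.assoc]
  refine le_antisymm (iSup₂_le fun Z ψ => iSup₂_le fun W φ => ?_)
    (iSup₂_le fun V a => iSup₂_le fun W φ => ?_)
  · refine (comp_mono le_rfl (psh_hom_comp_le _ _ b)).trans ?_
    change _ ≫ (⨆ (V : R) (a : A.Ob V), φ.elt a ≫ B.hom b (QFunctor.obj F a)) ≤ _
    simp only [comp_iSup]
    exact iSup₂_mono fun V a => le_iSup₂_of_le W φ le_rfl
  · refine le_iSup₂_of_le W (QFunctor.obj (pshMap F) φ : Presheaf B W)
      (le_iSup₂_of_le W φ (comp_mono le_rfl ?_))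
    have h1 := comp_mono ((psh B).id_le (QFunctor.obj (pshMap F) φ))
      (le_refl ((QFunctor.obj (pshMap F) φ : Presheaf B W).elt b))
    rw [Category.id_comp] at h1
    refine le_trans ?_ h1
    exact le_iSup₂ (f := fun (V : R) (a : A.Ob V) => φ.elt a ≫ B.hom b (QFunctor.obj F a)) V a

theorem pshMul_assoc (A : QCat R) :
    pshMap (pshMul A) ≫ pshMul A = pshMul (psh A) ≫ pshMul A := by
  refine pshFunctor_ext fun X Ξ Y a => ?_
  change (⨆ (Z : R) (ψ : Presheaf A Z), (⨆ (W : R) (Θ : Presheaf (psh A) W),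
      Presheaf.elt (A := psh (psh A)) (X := X) Ξ (Y := W) Θ ≫
        (psh A).hom ψ (QFunctor.obj (pshMul A) Θ)) ≫ ψ.elt a) =
    ⨆ (Z : R) (ψ : Presheaf A Z), (⨆ (W : R) (Θ : Presheaf (psh A) W),
      Presheaf.elt (A := psh (psh A)) (X := X) Ξ (Y := W) Θ ≫ Θ.elt (Y := Z) ψ) ≫ ψ.elt a
  simp only [iSup_comp, Category.assoc]
  refine le_antisymm (iSup₂_le fun Z ψ => iSup₂_le fun W Θ => ?_)
    (iSup₂_mono fun Z ψ => iSup₂_mono fun W Θ => comp_mono le_rfl (comp_mono ?_ le_rfl))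
  · refine (comp_mono le_rfl (psh_hom_comp_le _ _ a)).trans ?_
    change _ ≫ (⨆ (V : R) (φ : Presheaf A V), Θ.elt (Y := V) φ ≫ φ.elt a) ≤ _
    simp only [comp_iSup]
    exact iSup₂_mono fun V φ => le_iSup₂_of_le W Θ le_rfl
  · refine le_psh_hom fun V b => ?_
    exact le_iSup₂ (f := fun (V' : R) (φ : Presheaf A V') => Θ.elt (Y := V') φ ≫ φ.elt b) Z ψ

theorem pshMul_left_unit (A : QCat R) : yonedaQ (psh A) ≫ pshMul A = 𝟙 (psh A) :=
  pshFunctor_ext fun _ φ _ b => iSup_hom_elt (A := A) φ b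

theorem pshMul_right_unit (A : QCat R) : pshMap (yonedaQ A) ≫ pshMul A = 𝟙 (psh A) := by
  refine pshFunctor_ext fun X φ Y b => ?_
  change (⨆ (Z : R) (ψ : Presheaf A Z), (⨆ (W : R) (a : A.Ob W), Presheaf.elt φ a ≫
      (psh A).hom ψ (QFunctor.obj (yonedaQ A) a)) ≫ ψ.elt b) = Presheaf.elt φ b
  rw [← iSup_elt_hom φ b]
  simp only [iSup_comp, Category.assoc]
  refine le_antisymm (iSup₂_le fun Z ψ => iSup₂_mono fun W a => comp_mono le_rfl ?_)
    (iSup₂_le fun W a => ?_)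
  · exact psh_hom_comp_le ψ (QFunctor.obj (yonedaQ A) a) b
  · refine le_iSup₂_of_le W (QFunctor.obj (yonedaQ A) a : Presheaf A W)
      (le_iSup₂_of_le W a (comp_mono le_rfl ?_))
    have h1 := comp_mono ((psh A).id_le (QFunctor.obj (yonedaQ A) a))
      (le_refl (A.hom b a))
    rw [Category.id_comp] at h1
    exact h1

variable (R) in
/-- The presheaf monad on `Cat_cc(R)`: functor part `U P`, unit the Yoneda embeddings. -/
def presheafMonad : TwoMonad (CatCC R) where
  toFunctor := (presheafFunctor R).toFunctor ⋙ (forgetCocont R).toFunctor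
  η := yonedaUnit R
  μ :=
    { app := fun A => pshMul A.toQCat
      naturality := fun A B F => pshMul_naturality (A := A.toQCat) (B := B.toQCat) F }
  assoc A := pshMul_assoc A.toQCat
  left_unit A := pshMul_left_unit A.toQCat
  right_unit A := pshMul_right_unit A.toQCat
  map_mono h := (forgetCocont R).map_mono ((presheafFunctor R).map_mono h)

end Enriched

/-- `Idm(Q)`, the quantaloid of idempotents of `Q`. -/
abbrev Idm (Q : Type u) [Category.{u} Q] := Idempotents.Karoubi Q

/-- `Ord(Q) = Cat_cc(Idm(Q))`, the locally ordered category of ordered sheaves on `Q`. -/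
abbrev QOrd (Q : Type u) [Category.{u} Q] [Quantaloid Q] := CatCC (Idm Q)

end QSup

open QSup

universe u

namespace QSup

universe v u' v' u'' v''

/-! ### Formal properties of isomorphism, equivalence and biequivalence. -/

section Biequivalences

/-! Everything rests on one observation, valid over any small quantaloid: an enriched category `C`
is cocomplete exactly when its Yoneda embedding `Y` has a left adjoint `S : P C ⟶ C`, which sends a
presheaf to its supremum (`IsCocomplete.exists_isSupFunctor`, `IsSupFunctor.isCocomplete`). The
colimit of `F` weighted by `φ` is then `S (P F φ)`, and a functor `G` between cocomplete categories
is cocontinuous iff it commutes up to isomorphism with `P G` and the two supremum functors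
(`isCocontinuous_iff`).

The adjunction follows because each presheaf is the colimit of the representables weighted by
itself: a cocontinuous functor on `P A` is determined up to isomorphism by its restriction along
`Y`, and `F : A ⟶ B` extends to `P F` followed by the supremum functor of `B`. The inequality `P Y ≤
Y P` comes from half of the Yoneda lemma (`pshMap_yonedaQ_le`), and it forces the structure map of
every algebra to be left adjoint to `Y` (`Alg.isSupFunctor`). Being an algebra is thus the property
of being cocomplete, and homomorphisms are the cocontinuous functors.

For modules, a module `M` on `Q` yields a category over `Idm(Q)` whose objects of type `e` are the
elements fixed by `e`, and in which an arrow `b` lies below the hom-arrow from `y` to `x` iff `b · y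
≤ x`. The action and the joins of `M` are colimits there, namely tensors and joins of objects of one
type, so a cocontinuous functor restricts to a natural transformation on the objects of identity
type; it is recovered from that restriction because each idempotent splits through an identity
(`fixMap_natOfCocont`). Conversely, the objects of identity type of a cocomplete category, taken up
to isomorphism, form a module under tensors. Tensoring with the inclusion and the projection of each
idempotent makes its fixed-point category equivalent to the original one (`toFixCat_comp_ofFixCat`,
`ofFixCat_comp_toFixCat`). -/

theorem Iso2.comp {C : Type u} [Category.{v} C] [LocallyOrdered C] {X Y Z : C} {f f' : X ⟶ Y}
    {g g' : Y ⟶ Z} (hf : f ≈₂ f') (hg : g ≈₂ g') : f ≫ g ≈₂ f' ≫ g' :=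
  ⟨LocallyOrdered.comp_le_comp hf.1 hg.1, LocallyOrdered.comp_le_comp hf.2 hg.2⟩

theorem Iso2.trans {α : Type u} [Preorder α] {x y z : α} (h : x ≈₂ y) (h' : y ≈₂ z) : x ≈₂ z :=
  ⟨h.1.trans h'.1, h'.2.trans h.2⟩

theorem TwoFunctor.map_iso2 {C : Type u} [Category.{v} C] [LocallyOrdered C]
    {D : Type u'} [Category.{v'} D] [LocallyOrdered D] (F : TwoFunctor C D) {X Y : C}
    {f g : X ⟶ Y} (h : f ≈₂ g) : F.toFunctor.map f ≈₂ F.toFunctor.map g :=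
  ⟨F.map_mono h.1, F.map_mono h.2⟩

theorem Equivalent₂.trans {C : Type u} [Category.{v} C] [LocallyOrdered C] {X Y Z : C}
    (h : Equivalent₂ X Y) (h' : Equivalent₂ Y Z) : Equivalent₂ X Z := by
  obtain ⟨f, g, hfg, hgf⟩ := h
  obtain ⟨f', g', hfg', hgf'⟩ := h'
  refine ⟨f ≫ f', g' ≫ g, ?_, ?_⟩
  · have h1 := Iso2.comp (Iso2.comp (AntisymmRel.refl (· ≤ ·) f) hfg')
      (AntisymmRel.refl (· ≤ ·) g)
    simp only [Category.comp_id, Category.assoc] at h1 ⊢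
    exact h1.trans hfg
  · have h1 := Iso2.comp (Iso2.comp (AntisymmRel.refl (· ≤ ·) g') hgf)
      (AntisymmRel.refl (· ≤ ·) f')
    simp only [Category.comp_id, Category.assoc] at h1 ⊢
    exact h1.trans hgf'

theorem TwoFunctor.map_equivalent₂ {C : Type u} [Category.{v} C] [LocallyOrdered C]
    {D : Type u'} [Category.{v'} D] [LocallyOrdered D] (F : TwoFunctor C D) {X Y : C}
    (h : Equivalent₂ X Y) : Equivalent₂ (F.toFunctor.obj X) (F.toFunctor.obj Y) := by
  obtain ⟨f, g, hfg, hgf⟩ := h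
  refine ⟨F.toFunctor.map f, F.toFunctor.map g, ?_, ?_⟩
  · simpa using F.map_iso2 hfg
  · simpa using F.map_iso2 hgf

theorem TwoFunctor.IsBiequivalence.comp {C : Type u} [Category.{v} C] [LocallyOrdered C]
    {D : Type u'} [Category.{v'} D] [LocallyOrdered D]
    {E : Type u''} [Category.{v''} E] [LocallyOrdered E]
    {F : TwoFunctor C D} {G : TwoFunctor D E} (hF : F.IsBiequivalence) (hG : G.IsBiequivalence) :
    (F.comp G).IsBiequivalence := by
  refine ⟨fun X Y => ⟨fun f g => ?_, fun z => ?_⟩, fun Z => ?_⟩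
  · exact ((hF.1 X Y).1 f g).trans ((hG.1 _ _).1 _ _)
  · obtain ⟨y, hy⟩ := (hG.1 _ _).2 z
    obtain ⟨x, hx⟩ := (hF.1 X Y).2 y
    exact ⟨x, (G.map_iso2 hx).trans hy⟩
  · obtain ⟨Y, hY⟩ := hG.2 Z
    obtain ⟨X, hX⟩ := hF.2 Y
    exact ⟨X, (G.map_equivalent₂ hX).trans hY⟩

end Biequivalences

/-! ### Weighted colimits object by object, and suprema of presheaves. -/

section Colimits

variable {R : Type u} [Category.{u} R] [Quantaloid R]

/-- The underlying order on the objects of a fixed type. -/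
instance QCat.obPreorder (C : QCat R) (X : R) : Preorder (C.Ob X) where
  le a b := 𝟙 X ≤ C.hom a b
  le_refl := C.id_le
  le_trans a b c h h' := by
    have := comp_mono h' h
    rw [Category.id_comp] at this
    exact this.trans (C.hom_comp_le _ _ _)

theorem QCat.hom_anti_left {C : QCat R} {X Y : R} {a b : C.Ob X} (h : a ≤ b) (c : C.Ob Y) :
    C.hom b c ≤ C.hom a c := by
  have h1 : C.hom b c ≫ 𝟙 X ≤ C.hom b c ≫ C.hom a b := comp_mono le_rfl h
  rw [Category.comp_id] at h1
  exact h1.trans (C.hom_comp_le _ _ _)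

theorem QCat.hom_mono_right {C : QCat R} {X Y : R} {a b : C.Ob X} (h : a ≤ b) (c : C.Ob Y) :
    C.hom c a ≤ C.hom c b := by
  have h1 : 𝟙 X ≫ C.hom c a ≤ C.hom a b ≫ C.hom c a := comp_mono h le_rfl
  rw [Category.id_comp] at h1
  exact h1.trans (C.hom_comp_le _ _ _)

theorem QFunctor.obj_mono {A B : QCat R} (F : A ⟶ B) {X : R} {a b : A.Ob X} (h : a ≤ b) :
    QFunctor.obj F a ≤ QFunctor.obj F b :=
  le_trans (α := X ⟶ X) h (QFunctor.hom_le F a b)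

theorem psh_le_iff {A : QCat R} {X : R} {φ ψ : (psh A).Ob X} :
    φ ≤ ψ ↔ ∀ (Y : R) (a : A.Ob Y), Presheaf.elt φ a ≤ Presheaf.elt ψ a := by
  constructor
  · intro h Y a
    have h1 : 𝟙 X ≫ Presheaf.elt φ a ≤ (psh A).hom φ ψ ≫ Presheaf.elt φ a := comp_mono h le_rfl
    rw [Category.id_comp] at h1
    exact h1.trans (psh_hom_comp_le _ _ a)
  · intro h
    refine le_psh_hom fun Y b => ?_
    rw [Category.id_comp]
    exact h Y b

theorem le_psh_hom_iff {A : QCat R} {X Y : R} {ψ : Presheaf A Y} {φ : Presheaf A X} {f : X ⟶ Y} :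
    f ≤ (psh A).hom ψ φ ↔ ∀ (Z : R) (a : A.Ob Z), f ≫ ψ.elt a ≤ φ.elt a :=
  ⟨fun h _ a => (comp_mono h le_rfl).trans (psh_hom_comp_le ψ φ a), le_psh_hom⟩

/-- Weighted colimits are computed pointwise. -/
theorem isWeightedColimit_iff {A B C : QCat R} {Φ : Dist A B} {F : B ⟶ C} {K : A ⟶ C} :
    IsWeightedColimit Φ F K ↔ ∀ (X : R) (a : A.Ob X) (Z : R) (d : C.Ob Z) (f : Z ⟶ X),
      f ≤ C.hom (QFunctor.obj K a) d ↔
        ∀ (Y : R) (b : B.Ob Y), f ≫ Φ.elt b a ≤ C.hom (QFunctor.obj F b) d := by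
  constructor
  · intro h X a Z d f
    constructor
    · intro hf Y b
      refine (comp_mono hf le_rfl).trans (le_trans ?_ (h.1 b d))
      exact le_iSup₂ (f := fun (X : R) (a : A.Ob X) =>
        C.hom (QFunctor.obj K a) d ≫ Φ.elt b a) X a
    · intro hf
      -- This is `[Φ, C(F-, -)]` written elementwise; maximality of the distributor represented by
      -- `K` puts it below that distributor.
      let Ψ : Dist C A :=
        { elt := fun {X Y} a d => sSup {f : X ⟶ Y | ∀ (W : R) (b : B.Ob W),
            f ≫ Φ.elt b a ≤ C.hom (QFunctor.obj F b) d}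
          elt_hom_le := fun d a' a => by
            simp only [sSup_eq_iSup', iSup_comp]
            refine iSup_le fun f => le_iSup_of_le ⟨f.1 ≫ A.hom a a', fun W b => ?_⟩ le_rfl
            rw [Category.assoc]
            exact (comp_mono le_rfl (Φ.hom_elt_le _ _ _)).trans (f.2 W b)
          hom_elt_le := fun d d' a => by
            simp only [sSup_eq_iSup', comp_iSup]
            refine iSup_le fun f => le_iSup_of_le ⟨C.hom d' d ≫ f.1, fun W b => ?_⟩ le_rfl
            rw [Category.assoc]
            exact (comp_mono le_rfl (f.2 W b)).trans (C.hom_comp_le _ _ _) }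
      have hΨ : Ψ ≤ QFunctor.upper K := by
        refine h.2 ?_
        intro X Y b d
        refine iSup₂_le fun W a => ?_
        change sSup _ ≫ _ ≤ _
        simp only [sSup_eq_iSup', iSup_comp]
        exact iSup_le fun f => f.2 _ b
      exact le_trans (le_sSup (show f ∈ {f : Z ⟶ X | ∀ (W : R) (b : B.Ob W),
        f ≫ Φ.elt b a ≤ C.hom (QFunctor.obj F b) d} from hf)) (hΨ a d)
  · intro h
    constructor
    · intro X Y b d
      exact iSup₂_le fun W a => (h W a X d _).1 le_rfl Y b
    · intro Ψ hΨ X Y a d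
      refine (h Y a X d _).2 fun W b => le_trans ?_ (hΨ b d)
      exact le_iSup₂ (f := fun (Y : R) (a : A.Ob Y) => Ψ.elt a d ≫ Φ.elt b a) Y a

/-- `k` is the colimit of `F`, weighted by the presheaf `φ`. -/
def IsPointColimit {B C : QCat R} {X : R} (φ : Presheaf B X) (F : B ⟶ C) (k : C.Ob X) : Prop :=
  ∀ (Z : R) (d : C.Ob Z) (f : Z ⟶ X), f ≤ C.hom k d ↔
    ∀ (Y : R) (b : B.Ob Y), f ≫ φ.elt b ≤ C.hom (QFunctor.obj F b) d

theorem IsPointColimit.le_iff {B C : QCat R} {X : R} {φ : Presheaf B X} {F : B ⟶ C} {k : C.Ob X}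
    (h : IsPointColimit φ F k) (d : C.Ob X) :
    k ≤ d ↔ ∀ (Y : R) (b : B.Ob Y), φ.elt b ≤ C.hom (QFunctor.obj F b) d := by
  have h1 := h X d (𝟙 X)
  simp only [Category.id_comp] at h1
  exact h1

theorem IsPointColimit.elt_le {B C : QCat R} {X Y : R} {φ : Presheaf B X} {F : B ⟶ C} {k : C.Ob X}
    (h : IsPointColimit φ F k) (b : B.Ob Y) : φ.elt b ≤ C.hom (QFunctor.obj F b) k :=
  (h.le_iff k).1 le_rfl Y b

theorem IsPointColimit.congr {B C : QCat R} {X : R} {φ : Presheaf B X} {F : B ⟶ C} {k k' : C.Ob X}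
    (h : IsPointColimit φ F k) (h1 : k ≤ k') (h2 : k' ≤ k) : IsPointColimit φ F k' :=
  fun Z d f => Iff.trans ⟨fun hf => hf.trans (C.hom_anti_left h1 d),
    fun hf => hf.trans (C.hom_anti_left h2 d)⟩ (h Z d f)

theorem IsPointColimit.unique {B C : QCat R} {X : R} {φ : Presheaf B X} {F : B ⟶ C} {k k' : C.Ob X}
    (h : IsPointColimit φ F k) (h' : IsPointColimit φ F k') : k ≤ k' :=
  (h.le_iff k').2 fun _ b => h'.elt_le b

/-- Change of weight: a cocone on `B` restricts to the objects `F a`, and a cocone indexed by `A`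
extends along the hom-arrows `B(b, F a)` by functoriality of `G`. -/
theorem isPointColimit_pshMap {A B C : QCat R} {X : R} {φ : Presheaf A X} {F : A ⟶ B} {G : B ⟶ C}
    {k : C.Ob X} : IsPointColimit (QFunctor.obj (pshMap F) φ : Presheaf B X) G k ↔
      IsPointColimit φ (F ≫ G) k := by
  refine forall₃_congr fun Z d f => iff_congr Iff.rfl ⟨fun h Y a => ?_, fun h Y b => ?_⟩
  · refine le_trans (comp_mono le_rfl ?_) (h Y (QFunctor.obj F a))
    refine le_trans ?_ (le_iSup₂ (f := fun (Y' : R) (a' : A.Ob Y') =>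
      φ.elt a' ≫ B.hom (QFunctor.obj F a) (QFunctor.obj F a')) Y a)
    have := comp_mono (le_refl (φ.elt a)) (B.id_le (QFunctor.obj F a))
    rwa [Category.comp_id] at this
  · change f ≫ (⨆ (Y : R) (a : A.Ob Y), φ.elt a ≫ B.hom b (QFunctor.obj F a)) ≤ _
    simp only [comp_iSup, ← Category.assoc]
    refine iSup₂_le fun W a => ?_
    exact (comp_mono (h W a) (QFunctor.hom_le G _ _)).trans (C.hom_comp_le _ _ _)

/-- `S` sends each presheaf to its supremum; equivalently, it is left adjoint to the Yoneda
embedding. -/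
def IsSupFunctor {C : QCat R} (S : psh C ⟶ C) : Prop :=
  ∀ (X : R) (φ : Presheaf C X), IsPointColimit φ (𝟙 C) (QFunctor.obj S φ)

/-- Evaluation `(c, φ) ↦ φ(c)` is a distributor from `P C` to `C` that contains every presheaf. A
single colimit weighted by it gives all suprema at once, already assembled into a functor. -/
theorem IsCocomplete.exists_isSupFunctor {C : QCat R} (hC : IsCocomplete C) :
    ∃ S : psh C ⟶ C, IsSupFunctor S := by
  let Φ : Dist (psh C) C :=
    { elt := fun {X Y} c (φ : Presheaf C X) => φ.elt c
      elt_hom_le := fun φ a' a => Presheaf.elt_hom_le φ a' a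
      hom_elt_le := fun φ ψ a => psh_hom_comp_le ψ φ a }
  obtain ⟨S, hS⟩ := hC _ _ Φ (𝟙 C)
  exact ⟨S, fun X φ Z d f => isWeightedColimit_iff.1 hS X φ Z d f⟩

/-- The presheaf obtained by evaluating a distributor at an object. -/
def Dist.presheaf {A B : QCat R} (Φ : Dist A B) {X : R} (a : A.Ob X) : Presheaf B X where
  elt b := Φ.elt b a
  elt_hom_le b' b := Φ.elt_hom_le a b' b

theorem IsSupFunctor.isPointColimit {B C : QCat R} {S : psh C ⟶ C} (hS : IsSupFunctor S)
    (F : B ⟶ C) {X : R} (φ : Presheaf B X) :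
    IsPointColimit φ F (QFunctor.obj S (QFunctor.obj (pshMap F) φ)) := by
  have := isPointColimit_pshMap.1 (hS X (QFunctor.obj (pshMap F) φ))
  rwa [Category.comp_id] at this

theorem IsSupFunctor.isCocomplete {C : QCat R} {S : psh C ⟶ C} (hS : IsSupFunctor S) :
    IsCocomplete C := by
  intro A B Φ F
  refine ⟨QFunctor.mk (fun a => QFunctor.obj S (QFunctor.obj (pshMap F) (Φ.presheaf a)))
    (fun a' a => ?_), isWeightedColimit_iff.2 fun X a Z d f =>
      hS.isPointColimit F (Φ.presheaf a) Z d f⟩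
  refine le_trans (le_trans ?_ (QFunctor.hom_le (pshMap F) _ _)) (QFunctor.hom_le S _ _)
  exact le_psh_hom fun Z b => Φ.hom_elt_le _ _ _

/-- The hypotheses are the counit and unit of an adjunction between `S` and the Yoneda embedding;
the conclusion is its hom-arrow form, since `C(-, d)` is the representable presheaf at `d`. -/
theorem IsSupFunctor.of_adjoint {C : QCat R} {S : psh C ⟶ C} (h1 : yonedaQ C ≫ S ≤ 𝟙 C)
    (h2 : 𝟙 (psh C) ≤ S ≫ yonedaQ C) : IsSupFunctor S := by
  intro X φ Z d f
  constructor
  · intro hf Y c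
    have h3 : φ.elt c ≤ C.hom c (QFunctor.obj S φ) := psh_le_iff.1 (h2 X φ) Y c
    exact (comp_mono hf h3).trans (C.hom_comp_le _ _ _)
  · intro hf
    have h3 : f ≤ (psh C).hom φ (QFunctor.obj (yonedaQ C) d) := le_psh_hom hf
    exact h3.trans ((QFunctor.hom_le S _ _).trans (C.hom_mono_right (h1 Z d) _))

theorem IsSupFunctor.yoneda_comp {C : QCat R} {S : psh C ⟶ C} (hS : IsSupFunctor S) :
    yonedaQ C ≫ S ≈₂ 𝟙 C := by
  refine ⟨fun X c => ?_, fun X c => ?_⟩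
  · exact ((hS X (QFunctor.obj (yonedaQ C) c)).le_iff c).2 fun Y b => le_rfl
  · exact (C.id_le c).trans ((hS X (QFunctor.obj (yonedaQ C) c)).elt_le c)

/-- A functor on a cocomplete category is cocontinuous as soon as it preserves suprema of
presheaves. -/
theorem IsSupFunctor.isCocontinuous {C D : QCat R} {S : psh C ⟶ C} (hS : IsSupFunctor S)
    {G : C ⟶ D} (hG : ∀ (X : R) (φ : Presheaf C X),
      IsPointColimit φ G (QFunctor.obj G (QFunctor.obj S φ))) : IsCocontinuous G := by
  intro A B Φ F K hK
  refine isWeightedColimit_iff.2 fun X a => ?_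
  -- The value `K a` is isomorphic to the supremum of the presheaf `P F (Φ(-, a))`, and `G` is
  -- assumed to preserve that supremum.
  have h1 : IsPointColimit (Φ.presheaf a) F (QFunctor.obj K a) := isWeightedColimit_iff.1 hK X a
  have h2 := hS.isPointColimit F (Φ.presheaf a)
  exact (isPointColimit_pshMap.1 (hG X (QFunctor.obj (pshMap F) (Φ.presheaf a)))).congr
    (QFunctor.obj_mono G (h2.unique h1)) (QFunctor.obj_mono G (h1.unique h2))

/-- Cocontinuity speaks of colimits that form a functor. Cocompleteness embeds a single colimit in
the one weighted by evaluation of presheaves on `B`, and uniqueness up to isomorphism transfers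
preservation back to `k`. -/
theorem IsCocontinuous.isPointColimit {B C D : QCat R} (hC : IsCocomplete C) {G : C ⟶ D}
    (hG : IsCocontinuous G) {F : B ⟶ C} {X : R} {φ : Presheaf B X} {k : C.Ob X}
    (hk : IsPointColimit φ F k) : IsPointColimit φ (F ≫ G) (QFunctor.obj G k) := by
  let Φ : Dist (psh B) B :=
    { elt := fun {X Y} c (φ : Presheaf B X) => φ.elt c
      elt_hom_le := fun φ a' a => Presheaf.elt_hom_le φ a' a
      hom_elt_le := fun φ ψ a => psh_hom_comp_le ψ φ a }
  obtain ⟨K, hK⟩ := hC _ _ Φ F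
  have h1 : IsPointColimit φ F (QFunctor.obj K φ) := isWeightedColimit_iff.1 hK X φ
  have h2 : IsPointColimit φ (F ≫ G) (QFunctor.obj G (QFunctor.obj K φ)) :=
    isWeightedColimit_iff.1 (hG _ _ _ _ _ hK) X φ
  exact h2.congr (QFunctor.obj_mono G (h1.unique hk)) (QFunctor.obj_mono G (hk.unique h1))

/-- Both sides of the universal property say that `f ≫ Θ(φ) ≫ φ(a) ≤ ψ(a)` for all `φ` and `a`. -/
theorem isSupFunctor_pshMul (A : QCat R) : IsSupFunctor (pshMul A) := by
  intro X Θ Z ψ f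
  refine le_psh_hom_iff.trans ⟨fun h Y φ => le_psh_hom fun W a => ?_, fun h Y a => ?_⟩
  · refine le_trans ?_ (h W a)
    rw [Category.assoc]
    exact comp_mono le_rfl (le_iSup₂ (f := fun (Y : R) (φ : Presheaf A Y) =>
      Presheaf.elt Θ (Y := Y) φ ≫ φ.elt a) Y φ)
  · change f ≫ (⨆ (Y : R) (φ : Presheaf A Y), Presheaf.elt Θ (Y := Y) φ ≫ φ.elt a) ≤ _
    simp only [comp_iSup, ← Category.assoc]
    exact iSup₂_le fun W φ => (comp_mono (h W φ) le_rfl).trans (psh_hom_comp_le _ _ a)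

/-- Every presheaf is the colimit of the representables, weighted by itself. -/
theorem isPointColimit_yonedaQ {A : QCat R} {X : R} (φ : Presheaf A X) :
    IsPointColimit φ (yonedaQ A) (C := psh A) φ := by
  have h := (isSupFunctor_pshMul A).isPointColimit (yonedaQ A) φ
  -- The colimit of the Yoneda embedding weighted by `φ` is computed by the multiplication, so the
  -- right unit law identifies it with `φ`.
  have h1 : QFunctor.obj (pshMul A) (QFunctor.obj (pshMap (yonedaQ A)) φ) = φ :=
    congrArg (fun F : psh A ⟶ psh A => QFunctor.obj F φ) (pshMul_right_unit A)
  rwa [h1] at h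

theorem yonedaQ_comp_pshMap {A B : QCat R} (F : A ⟶ B) :
    yonedaQ A ≫ pshMap F = F ≫ yonedaQ B := by
  refine pshFunctor_ext fun X a Y b => le_antisymm (iSup₂_le fun Z a' => ?_) ?_
  · exact (comp_mono (QFunctor.hom_le F _ _) le_rfl).trans (B.hom_comp_le _ _ _)
  · refine le_iSup₂_of_le X a ?_
    have := comp_mono (A.id_le a) (le_refl (B.hom b (QFunctor.obj F a)))
    rwa [Category.id_comp] at this

theorem IsCocontinuous.isPointColimit_psh {A B : QCat R} {G : psh A ⟶ B} (hG : IsCocontinuous G)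
    {X : R} (φ : Presheaf A X) : IsPointColimit φ (yonedaQ A ≫ G) (QFunctor.obj G φ) :=
  hG.isPointColimit (psh_isCocomplete A) (isPointColimit_yonedaQ φ)

theorem IsSupFunctor.isCocontinuous_pshMap_comp {A B : QCat R} {S : psh B ⟶ B}
    (hS : IsSupFunctor S) (F : A ⟶ B) : IsCocontinuous (pshMap F ≫ S) := by
  -- The right adjoint is the nerve `b ↦ B(F-, b)`.
  let G : B ⟶ psh A := QFunctor.mk
    (fun b => Presheaf.mk (fun a => B.hom (QFunctor.obj F a) b)
      (fun _ _ => (comp_mono le_rfl (QFunctor.hom_le F _ _)).trans (B.hom_comp_le _ _ _)))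
    (fun _ _ => le_psh_hom fun _ _ => B.hom_comp_le _ _ _)
  refine isCocontinuous_of_adjoint (pshMap F ≫ S) G fun {X Y} φ d => ?_
  have h (f : X ⟶ Y) : f ≤ B.hom (QFunctor.obj (pshMap F ≫ S) φ) d ↔
      f ≤ (psh A).hom φ (QFunctor.obj G d) :=
    (hS.isPointColimit F φ X d f).trans (le_psh_hom_iff (φ := QFunctor.obj G d)).symm
  exact le_antisymm ((h _).1 le_rfl) ((h _).2 le_rfl)

end Colimits

/-! ### The adjunction between presheaves and the forgetful functor, and the KZ inequality. -/

section Presheaves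

variable (R : Type u) [Category.{u} R] [Quantaloid R]

/-- Order is reflected because a cocontinuous `g` sends `φ` to the colimit of its restriction to
representables, weighted by `φ`. A functor `F` into a cocomplete category extends by sending `φ` to
the supremum of `P F φ`. -/
theorem isLeftAdjoint₂_presheafFunctor :
    IsLeftAdjoint₂ (presheafFunctor R) (forgetCocont R) (yonedaUnit R) := by
  intro A B
  refine ⟨fun g g' => ⟨fun h => LocallyOrdered.comp_le_comp le_rfl h, fun h X φ => ?_⟩,
    fun F => ?_⟩
  · refine ((g.2.isPointColimit_psh φ).le_iff _).2 fun Y a => ?_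
    exact ((g'.2.isPointColimit_psh φ).elt_le a).trans (QCat.hom_anti_left (h Y a) _)
  · obtain ⟨S, hS⟩ := B.cocomplete.exists_isSupFunctor
    refine ⟨⟨pshMap F ≫ S, hS.isCocontinuous_pshMap_comp F⟩, ?_⟩
    let F' : A.toQCat ⟶ B.toQCat := F
    have h2 : yonedaQ A.toQCat ≫ pshMap F' ≫ S ≈₂ F' := by
      rw [← Category.assoc, yonedaQ_comp_pshMap, Category.assoc]
      have := Iso2.comp (AntisymmRel.refl (· ≤ ·) F') hS.yoneda_comp
      rwa [Category.comp_id] at this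
    exact h2

theorem isCocontinuous_pshMul (A : QCat R) : IsCocontinuous (pshMul A) := by
  have := (isSupFunctor_pshMul A).isCocontinuous_pshMap_comp (𝟙 (psh A))
  rwa [pshMap_id, Category.id_comp] at this

/-- The triangle identity characterises the counit component as the transpose of the identity; the
multiplication qualifies, being cocontinuous and satisfying the left unit law. -/
theorem presheafMonad_mul (A : CatCC R) :
    ∃ ε : (presheafFunctor R).obj ((forgetCocont R).obj ((presheafFunctor R).obj A)) ⟶
        (presheafFunctor R).obj A,
      (yonedaUnit R).app ((forgetCocont R).obj ((presheafFunctor R).obj A)) ≫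
        (forgetCocont R).map ε ≈₂ 𝟙 _ ∧
      (presheafMonad R).μ.app A = (forgetCocont R).map ε := by
  refine ⟨⟨pshMul A.toQCat, isCocontinuous_pshMul R _⟩, ?_, rfl⟩
  exact AntisymmRel.of_eq (pshMul_left_unit A.toQCat)

/-- By half of the Yoneda lemma, `φ(a)` lies below the hom-arrow `P A (Y a, φ)`. Composing with `P A
(ψ, Y a)` gives an arrow below `P A (ψ, φ)`. -/
theorem pshMap_yonedaQ_le {R : Type u} [Category.{u} R] [Quantaloid R] (A : QCat R) :
    pshMap (yonedaQ A) ≤ yonedaQ (psh A) := by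
  refine le_iff_psh.2 fun X φ Y ψ => iSup₂_le fun Z a => ?_
  refine le_trans (comp_mono ?_ le_rfl) ((psh A).hom_comp_le φ (QFunctor.obj (yonedaQ A) a) ψ)
  exact le_psh_hom fun W b => Presheaf.elt_hom_le φ a b

theorem presheafMonad_isKZ : (presheafMonad R).IsKZ := fun A => pshMap_yonedaQ_le A.toQCat

end Presheaves

/-! ### Algebras of the presheaf doctrine are cocomplete categories. -/

section Algebras

variable {R : Type u} [Category.{u} R] [Quantaloid R]

/-- In the presheaf doctrine, structure maps are left adjoint to units. -/
theorem Alg.isSupFunctor (A : Alg (presheafMonad R)) :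
    IsSupFunctor (C := A.carrier.toQCat) A.str := by
  let a : psh A.carrier.toQCat ⟶ A.carrier.toQCat := A.str
  have hu : yonedaQ A.carrier.toQCat ≫ a ≈₂ 𝟙 _ := A.unit
  refine IsSupFunctor.of_adjoint hu.1 ?_
  -- The KZ inequality replaces `P Y` by the Yoneda embedding of `P A`, and naturality moves that
  -- past `P a`. Applying `P` to `1 ≤ Y ≫ a` bounds the left side below by the identity, which is
  -- the missing unit of the adjunction.
  have h2 : pshMap (yonedaQ A.carrier.toQCat) ≫ pshMap a ≤ a ≫ yonedaQ A.carrier.toQCat := by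
    rw [← yonedaQ_comp_pshMap]
    exact LocallyOrdered.comp_le_comp (pshMap_yonedaQ_le _) le_rfl
  have h3 := pshMap_mono hu.2
  rw [pshMap_id, pshMap_comp] at h3
  exact h3.trans h2

/-- Both composites compute the colimit of `S` weighted by `Θ`: one because `S`, a left adjoint,
preserves the supremum given by the multiplication, the other by change of weight. -/
theorem IsSupFunctor.assoc {C : QCat R} {S : psh C ⟶ C} (hS : IsSupFunctor S) :
    pshMul C ≫ S ≈₂ pshMap S ≫ S := by
  have hS' : IsCocontinuous S := by
    have := hS.isCocontinuous_pshMap_comp (𝟙 C)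
    rwa [pshMap_id, Category.id_comp] at this
  have h1 (X : R) (Θ : Presheaf (psh C) X) :
      IsPointColimit Θ S (QFunctor.obj S (QFunctor.obj (pshMul C) Θ)) := by
    have := hS'.isPointColimit (psh_isCocomplete C) (isSupFunctor_pshMul C X Θ)
    rwa [Category.id_comp] at this
  have h2 (X : R) (Θ : Presheaf (psh C) X) := hS.isPointColimit S Θ
  exact ⟨fun X Θ => (h1 X Θ).unique (h2 X Θ), fun X Θ => (h2 X Θ).unique (h1 X Θ)⟩

/-- A functor between cocomplete categories is cocontinuous precisely when it is a homomorphism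
for the supremum functors. -/
theorem isCocontinuous_iff {A B : QCat R} {S : psh A ⟶ A} {T : psh B ⟶ B} (hS : IsSupFunctor S)
    (hT : IsSupFunctor T) (G : A ⟶ B) : IsCocontinuous G ↔ S ≫ G ≈₂ pshMap G ≫ T := by
  have h2 (X : R) (φ : Presheaf A X) := hT.isPointColimit G φ
  constructor
  · intro hG
    have h1 (X : R) (φ : Presheaf A X) :
        IsPointColimit φ G (QFunctor.obj G (QFunctor.obj S φ)) := by
      have := hG.isPointColimit hS.isCocomplete (hS X φ)
      rwa [Category.id_comp] at this
    exact ⟨fun X φ => (h1 X φ).unique (h2 X φ), fun X φ => (h2 X φ).unique (h1 X φ)⟩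
  · intro hG
    exact hS.isCocontinuous fun X φ => (h2 X φ).congr (hG.2 X φ) (hG.1 X φ)

variable (R) in
/-- The comparison 2-functor: a cocomplete category is an algebra, with structure map the
supremum functor. -/
noncomputable def cocontToAlg : TwoFunctor (Cocont R) (Alg (presheafMonad R)) where
  obj A :=
    { carrier := (forgetCocont R).obj A
      str := A.cocomplete.exists_isSupFunctor.choose
      unit := A.cocomplete.exists_isSupFunctor.choose_spec.yoneda_comp
      assoc := A.cocomplete.exists_isSupFunctor.choose_spec.assoc }
  map {A B} F :=
    { hom := F.1
      comm := (isCocontinuous_iff A.cocomplete.exists_isSupFunctor.choose_spec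
        B.cocomplete.exists_isSupFunctor.choose_spec F.1).1 F.2 }
  map_id _ := rfl
  map_comp _ _ := rfl
  map_mono h := h

theorem cocontToAlg_isBiequivalence : (cocontToAlg R).IsBiequivalence := by
  refine ⟨fun A B => ⟨fun F G => Iff.rfl, fun F => ?_⟩, fun A => ?_⟩
  · exact ⟨⟨F.hom, (isCocontinuous_iff A.cocomplete.exists_isSupFunctor.choose_spec
      B.cocomplete.exists_isSupFunctor.choose_spec F.hom).2 F.comm⟩, AntisymmRel.refl _ _⟩
  · let C : Cocont R := ⟨A.carrier.toQCat, A.isSupFunctor.isCocomplete⟩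
    have hC := C.cocomplete.exists_isSupFunctor.choose_spec
    -- The chosen supremum functor and the given structure map may differ, but only up to
    -- isomorphism: the identity functor is cocontinuous, hence a homomorphism in both directions.
    have hid := isCocontinuous_iff hC A.isSupFunctor (𝟙 C.toQCat)
    have hid' := isCocontinuous_iff A.isSupFunctor hC (𝟙 C.toQCat)
    have h : IsCocontinuous (𝟙 C.toQCat) := fun _ _ _ _ _ h => h
    exact ⟨C, ⟨𝟙 C.toQCat, hid.1 h⟩, ⟨𝟙 C.toQCat, hid'.1 h⟩, AntisymmRel.refl _ _,
      AntisymmRel.refl _ _⟩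

end Algebras

end QSup

namespace QSup

universe w

/-! ### Modules on a quantaloid in terms of elements and actions. -/

section ModuleActions

variable {Q : Type u} [Category.{u} Q] [Quantaloid Q]

/-- The elements of type `X` of a module. -/
abbrev modElt (M : QMod Q) (X : Q) : Type u := (M.functor.obj (Opposite.op X)).carrier

/-- The action of an arrow on the elements of a module. -/
def modAct (M : QMod Q) {X Y : Q} (b : X ⟶ Y) (y : modElt M Y) : modElt M X :=
  SupLat.fn (M.functor.map b.op) y

theorem modAct_id (M : QMod Q) {X : Q} (x : modElt M X) : modAct M (𝟙 X) x = x := by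
  have h := M.functor.map_id (Opposite.op X)
  exact congrArg (fun f => SupLat.fn f x) h

theorem modAct_comp (M : QMod Q) {X Y Z : Q} (b : X ⟶ Y) (c : Y ⟶ Z) (z : modElt M Z) :
    modAct M (b ≫ c) z = modAct M b (modAct M c z) := by
  have h := M.functor.map_comp c.op b.op
  exact congrArg (fun f => SupLat.fn f z) h

theorem modAct_iSup (M : QMod Q) {X Y : Q} (b : X ⟶ Y) {ι : Sort w} (y : ι → modElt M Y) :
    modAct M b (⨆ i, y i) = ⨆ i, modAct M b (y i) :=
  SupLat.fn_iSup _ _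

theorem modAct_mono (M : QMod Q) {X Y : Q} (b : X ⟶ Y) {y y' : modElt M Y} (h : y ≤ y') :
    modAct M b y ≤ modAct M b y' :=
  OrderHomClass.mono (F := sSupHom (modElt M Y) (modElt M X)) (M.functor.map b.op) h

theorem iSup_modAct (M : QMod Q) {X Y : Q} {ι : Type w} (b : ι → (X ⟶ Y)) (y : modElt M Y) :
    modAct M (⨆ i, b i) y = ⨆ i, modAct M (b i) y := by
  have h1 : (⨆ i, b i).op = sSup (Set.range fun i => (b i).op) := by
    refine le_antisymm (iSup_le (a := (sSup (Set.range fun i => (b i).op)).unop) fun i => ?_)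
      (sSup_le ?_)
    · exact le_sSup (a := (b i).op) ⟨i, rfl⟩
    · rintro _ ⟨i, rfl⟩
      exact le_iSup b i
  have h2 := M.map_sSup (Set.range fun i => (b i).op)
  rw [← h1, ← Set.range_comp] at h2
  have h3 : modAct M (⨆ i, b i) y = SupLat.fn (sSup (Set.range
    ((fun f => M.functor.map f) ∘ fun i => (b i).op))) y := congrArg (fun f => SupLat.fn f y) h2
  rw [h3]
  change (⨆ f : Set.range ((fun f => M.functor.map f) ∘ fun i => (b i).op), SupLat.fn f.1 y) = _
  exact iSup_range' (fun f => SupLat.fn f y) _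

theorem modAct_mono_left (M : QMod Q) {X Y : Q} {b b' : X ⟶ Y} (h : b ≤ b') (y : modElt M Y) :
    modAct M b y ≤ modAct M b' y := by
  have h1 : b' = ⨆ i : Bool, cond i b b' := by rw [iSup_bool_eq]; exact (sup_eq_right.2 h).symm
  rw [h1, iSup_modAct]
  exact le_iSup (fun i : Bool => modAct M (cond i b b') y) true

/-- A natural transformation of modules, on elements. -/
def modMap {M N : QMod Q} (α : M ⟶ N) {X : Q} (x : modElt M X) : modElt N X :=
  SupLat.fn (NatTrans.app α (Opposite.op X)) x

theorem modMap_modAct {M N : QMod Q} (α : M ⟶ N) {X Y : Q} (b : X ⟶ Y) (y : modElt M Y) :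
    modMap α (modAct M b y) = modAct N b (modMap α y) :=
  congrArg (fun f => SupLat.fn f y) (NatTrans.naturality α b.op)

theorem modMap_iSup {M N : QMod Q} (α : M ⟶ N) {X : Q} {ι : Sort w} (x : ι → modElt M X) :
    modMap α (⨆ i, x i) = ⨆ i, modMap α (x i) :=
  SupLat.fn_iSup _ _

theorem modMap_mono {M N : QMod Q} (α : M ⟶ N) {X : Q} {x x' : modElt M X} (h : x ≤ x') :
    modMap α x ≤ modMap α x' :=
  OrderHomClass.mono (F := sSupHom (modElt M X) (modElt N X))
    (NatTrans.app α (Opposite.op X)) h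

end ModuleActions

/-! ### From modules on `Q` to cocomplete categories over `Idm(Q)`. -/

section FixedPoints

variable {Q : Type u} [Category.{u} Q] [Quantaloid Q]

/-- The category enriched in `Idm(Q)` of a module: the objects of type `e` are the elements fixed
by the idempotent `e`. -/
def fixCat (M : QMod Q) : QCat (Idm Q) where
  Ob e := {x : modElt M e.X // modAct M e.p x = x}
  hom {e f} y x := sSup {b : e ⟶ f | modAct M b.f y.1 ≤ x.1}
  hom_comp_le {e f g} x y z := by
    simp only [sSup_eq_iSup', iSup_comp, comp_iSup]
    refine iSup_le fun c => iSup_le fun b => le_iSup_of_le ⟨b.1 ≫ c.1, ?_⟩ le_rfl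
    change modAct M (b.1.f ≫ c.1.f) z.1 ≤ x.1
    rw [modAct_comp]
    exact (modAct_mono M _ c.2).trans b.2
  id_le {e} x := le_sSup (show modAct M e.p x.1 ≤ x.1 from x.2.le)

/-- The action preserves suprema of arrows, so the supremum defining the hom-arrow satisfies its own
defining inequality. -/
theorem le_fixCat_hom_iff {M : QMod Q} {e f : Idm Q} {b : e ⟶ f} {y : (fixCat M).Ob f}
    {x : (fixCat M).Ob e} : b ≤ (fixCat M).hom y x ↔ modAct M b.f y.1 ≤ x.1 := by
  refine ⟨fun h => (modAct_mono_left M (show b.f ≤ ((fixCat M).hom y x).f from h) y.1).trans ?_,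
    fun h => le_sSup h⟩
  change modAct M (⨆ c : {b : e ⟶ f | modAct M b.f y.1 ≤ x.1}, c.1.f) y.1 ≤ x.1
  rw [iSup_modAct]
  exact iSup_le fun c => c.2

theorem fixCat_le_iff {M : QMod Q} {e : Idm Q} {x y : (fixCat M).Ob e} : y ≤ x ↔ y.1 ≤ x.1 := by
  refine le_fixCat_hom_iff.trans ?_
  change modAct M e.p y.1 ≤ x.1 ↔ _
  rw [y.2]

theorem modAct_left_fixed {M : QMod Q} {e f : Idm Q} (b : e ⟶ f) (y : modElt M f.X) :
    modAct M e.p (modAct M b.f y) = modAct M b.f y := by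
  rw [← modAct_comp, Idempotents.Karoubi.p_comp]

theorem modAct_iSup_fixed {M : QMod Q} {e : Idm Q} {ι : Sort w} {x : ι → modElt M e.X}
    (h : ∀ i, modAct M e.p (x i) = x i) : modAct M e.p (⨆ i, x i) = ⨆ i, x i := by
  rw [modAct_iSup]
  exact iSup_congr h

theorem fixCat_isCocomplete (M : QMod Q) : IsCocomplete (fixCat M) := by
  -- The supremum of `φ` is the join of all `φ(y) · y`. It is fixed by `e` because each arrow `φ(y)`
  -- absorbs `e`.
  have key {e : Idm Q} (φ : Presheaf (fixCat M) e) (g : Idm Q) (z : (fixCat M).Ob g) (b : g ⟶ e) :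
      modAct M b.f (⨆ (f : Idm Q) (y : (fixCat M).Ob f), modAct M (φ.elt y).f y.1) ≤ z.1 ↔
      ∀ (f : Idm Q) (y : (fixCat M).Ob f), b ≫ φ.elt y ≤ (fixCat M).hom y z := by
    simp only [le_fixCat_hom_iff, modAct_iSup, iSup_le_iff, Idempotents.Karoubi.comp_f,
      modAct_comp]
  have hfix {e : Idm Q} (φ : Presheaf (fixCat M) e) : modAct M e.p
      (⨆ (f : Idm Q) (y : (fixCat M).Ob f), modAct M (φ.elt y).f y.1) =
      ⨆ (f : Idm Q) (y : (fixCat M).Ob f), modAct M (φ.elt y).f y.1 :=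
    modAct_iSup_fixed fun f => modAct_iSup_fixed fun y => modAct_left_fixed _ _
  let S : psh (fixCat M) ⟶ fixCat M := QFunctor.mk
    (fun φ => ⟨_, hfix φ⟩) (fun {e f} ψ φ => le_fixCat_hom_iff.2 ((key ψ e ⟨_, hfix φ⟩ _).2
      fun g y => le_fixCat_hom_iff.2 ((modAct_mono_left M (psh_hom_comp_le ψ φ y :) y.1).trans
        (le_iSup₂ (f := fun (g : Idm Q) (y : (fixCat M).Ob g) =>
          modAct M (Presheaf.elt φ y).f y.1) g y))))
  have hS : IsSupFunctor S := fun e φ g z b => le_fixCat_hom_iff.trans (key φ g z b)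
  exact hS.isCocomplete

/-- The enriched functor induced by a natural transformation of modules. -/
def fixMap {M N : QMod Q} (α : M ⟶ N) : fixCat M ⟶ fixCat N := QFunctor.mk
  (fun x => ⟨modMap α x.1, by rw [← modMap_modAct, x.2]⟩)
  (fun y x => le_fixCat_hom_iff.2 (by
    rw [← modMap_modAct]
    exact modMap_mono α (le_fixCat_hom_iff.1 le_rfl)))

theorem fixMap_isCocontinuous {M N : QMod Q} (α : M ⟶ N) : IsCocontinuous (fixMap α) := by
  -- The right adjoint of `α` on elements fixed by `e`: restricting the join to fixed elements keeps
  -- the result fixed.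
  let r {e : Idm Q} (y : modElt N e.X) : (fixCat M).Ob e :=
    ⟨⨆ x : {x : (fixCat M).Ob e // modMap α x.1 ≤ y}, x.1.1, modAct_iSup_fixed fun x => x.1.2⟩
  have hr {e : Idm Q} (x : (fixCat M).Ob e) (y : modElt N e.X) :
      x.1 ≤ (r y).1 ↔ modMap α x.1 ≤ y := by
    refine ⟨fun h => (modMap_mono α h).trans ?_, fun h =>
      le_iSup (fun x : {x : (fixCat M).Ob e // modMap α x.1 ≤ y} => x.1.1) ⟨x, h⟩⟩
    change modMap α (⨆ x : {x : (fixCat M).Ob e // modMap α x.1 ≤ y}, x.1.1) ≤ y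
    rw [modMap_iSup]
    exact iSup_le fun x => x.2
  have hact {e f : Idm Q} (b : e ⟶ f) (x : (fixCat M).Ob f) (y : modElt N e.X) :
      modAct M b.f x.1 ≤ (r y).1 ↔ modAct N b.f (modMap α x.1) ≤ y := by
    rw [← modMap_modAct]
    exact hr ⟨modAct M b.f x.1, modAct_left_fixed b x.1⟩ y
  let G : fixCat N ⟶ fixCat M := QFunctor.mk (fun {e} y => r (e := e) y.1)
    (fun y x => le_fixCat_hom_iff.2 ((hact _ _ _).2
      ((modAct_mono N _ ((hr (r y.1) y.1).1 le_rfl)).trans (le_fixCat_hom_iff.1 le_rfl))))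
  refine isCocontinuous_of_adjoint (fixMap α) G fun {e f} x y => ?_
  have h (b : e ⟶ f) : b ≤ (fixCat N).hom (QFunctor.obj (fixMap α) x) y ↔
      b ≤ (fixCat M).hom x (QFunctor.obj G y) :=
    le_fixCat_hom_iff.trans ((hact b x y.1).symm.trans
      (le_fixCat_hom_iff (x := QFunctor.obj G y)).symm)
  exact le_antisymm ((h _).1 le_rfl) ((h _).2 le_rfl)

variable (Q) in
/-- The 2-functor sending a module on `Q` to a cocomplete category enriched in `Idm(Q)`. -/
def modToCocont : TwoFunctor (QMod Q) (Cocont (Idm Q)) where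
  obj M := ⟨fixCat M, fixCat_isCocomplete M⟩
  map α := ⟨fixMap α, fixMap_isCocontinuous α⟩
  map_id _ := rfl
  map_comp _ _ := rfl
  map_mono h e x := fixCat_le_iff.2 (h (Opposite.op e.X) x.1)

end FixedPoints

/-! ### Tensors and joins as weighted colimits. -/

section Tensors

variable {R : Type u} [Category.{u} R] [Quantaloid R]

/-- The presheaf `C(-, c) ∘ b`, whose supremum is the tensor of `c` with `b`. -/
def tensorPresheaf (C : QCat R) {X Y : R} (b : X ⟶ Y) (c : C.Ob Y) : Presheaf C X where
  elt x := b ≫ C.hom x c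
  elt_hom_le x' x := by
    rw [Category.assoc]
    exact comp_mono le_rfl (C.hom_comp_le _ _ _)

/-- The join of the representables at the members of `s`. -/
def joinPresheaf (C : QCat R) {X : R} (s : Set (C.Ob X)) : Presheaf C X where
  elt x := ⨆ c : s, C.hom x c.1
  elt_hom_le x' x := by
    rw [iSup_comp]
    exact iSup_mono fun c => C.hom_comp_le _ _ _

theorem isPointColimit_tensorPresheaf {C D : QCat R} {X Y : R} {b : X ⟶ Y} {c : C.Ob Y}
    {G : C ⟶ D} {k : D.Ob X} : IsPointColimit (tensorPresheaf C b c) G k ↔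
      ∀ (Z : R) (d : D.Ob Z) (f : Z ⟶ X),
        f ≤ D.hom k d ↔ f ≫ b ≤ D.hom (QFunctor.obj G c) d := by
  refine forall₃_congr fun Z d f => iff_congr Iff.rfl ⟨fun h => ?_, fun h W x => ?_⟩
  · refine le_trans ?_ (h Y c)
    have := comp_mono (le_refl (f ≫ b)) (C.id_le c)
    rwa [Category.comp_id, Category.assoc] at this
  · change f ≫ b ≫ C.hom x c ≤ _
    rw [← Category.assoc]
    exact (comp_mono h (QFunctor.hom_le G _ _)).trans (D.hom_comp_le _ _ _)

theorem isPointColimit_joinPresheaf {C D : QCat R} {X : R} {s : Set (C.Ob X)}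
    {G : C ⟶ D} {k : D.Ob X} : IsPointColimit (joinPresheaf C s) G k ↔
      ∀ (Z : R) (d : D.Ob Z) (f : Z ⟶ X),
        f ≤ D.hom k d ↔ ∀ c ∈ s, f ≤ D.hom (QFunctor.obj G c) d := by
  refine forall₃_congr fun Z d f => iff_congr Iff.rfl ⟨fun h c hc => ?_, fun h W x => ?_⟩
  · refine le_trans ?_ (h X c)
    have := comp_mono (le_refl f) ((C.id_le c).trans
      (le_iSup (fun c' : s => C.hom c c'.1) ⟨c, hc⟩))
    rwa [Category.comp_id] at this
  · change f ≫ (⨆ c : s, C.hom x c.1) ≤ _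
    rw [comp_iSup]
    exact iSup_le fun c => (comp_mono (h c.1 c.2) (QFunctor.hom_le G _ _)).trans
      (D.hom_comp_le _ _ _)

end Tensors

/-! ### Cocontinuous functors between fixed-point categories come from natural transformations. -/

section Comparison

variable {Q : Type u} [Category.{u} Q] [Quantaloid Q]

/-- An object of `Q` as an identity idempotent. -/
abbrev idm (X : Q) : Idm Q := (Idempotents.toKaroubi Q).obj X

/-- An element of a module, as an object whose type is an identity. -/
def fixOb {M : QMod Q} {X : Q} (x : modElt M X) : (fixCat M).Ob (idm X) :=
  ⟨x, modAct_id M x⟩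

/-- In a fixed-point category `b · y` is the tensor of `y` with `b`, hence a colimit that `H`
preserves. The isomorphism so obtained is an equality, because module elements are partially
ordered. -/
theorem fixMap_obj_act {M N : QMod Q} {H : fixCat M ⟶ fixCat N} (hH : IsCocontinuous H)
    {e f : Idm Q} (b : e ⟶ f) (y : (fixCat M).Ob f) :
    (QFunctor.obj H (⟨modAct M b.f y.1, modAct_left_fixed b y.1⟩ : (fixCat M).Ob e)).1 =
      modAct N b.f (QFunctor.obj H y).1 := by
  have tens (P : QMod Q) (y : (fixCat P).Ob f) (g : Idm Q) (z : (fixCat P).Ob g) (a : g ⟶ e) :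
      a ≤ (fixCat P).hom (⟨modAct P b.f y.1, modAct_left_fixed b y.1⟩ : (fixCat P).Ob e) z ↔
        a ≫ b ≤ (fixCat P).hom y z := by
    refine le_fixCat_hom_iff.trans (Iff.trans ?_ le_fixCat_hom_iff.symm)
    exact iff_of_eq (congrArg (· ≤ z.1) (modAct_comp P a.f b.f y.1).symm)
  have h1 := hH.isPointColimit (fixCat_isCocomplete M) (F := 𝟙 _)
    (isPointColimit_tensorPresheaf.2 (tens M y))
  rw [Category.id_comp] at h1
  have h2 : IsPointColimit (tensorPresheaf (fixCat M) b y) H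
      (⟨modAct N b.f (QFunctor.obj H y).1, modAct_left_fixed b _⟩ : (fixCat N).Ob e) :=
    isPointColimit_tensorPresheaf.2 (tens N (QFunctor.obj H y))
  exact le_antisymm (fixCat_le_iff.1 (h1.unique h2)) (fixCat_le_iff.1 (h2.unique h1))

/-- Joins in the module are colimits weighted by joins of representables, so `H` preserves them. -/
theorem fixMap_obj_sSup {M N : QMod Q} {H : fixCat M ⟶ fixCat N} (hH : IsCocontinuous H)
    {X : Q} (s : Set (modElt M X)) :
    (QFunctor.obj H (fixOb (sSup s))).1 = sSup ((fun x => (QFunctor.obj H (fixOb x)).1) '' s) := by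
  have h0 : IsPointColimit (joinPresheaf (fixCat M) (fixOb '' s)) (𝟙 _) (fixOb (sSup s)) := by
    refine isPointColimit_joinPresheaf.2 fun g z a => ?_
    rw [le_fixCat_hom_iff, Set.forall_mem_image]
    change modAct M a.f (sSup s) ≤ z.1 ↔ _
    rw [sSup_eq_iSup']
    simp only [modAct_iSup, iSup_le_iff, Subtype.forall]
    exact forall₂_congr fun x _ => (le_fixCat_hom_iff (y := fixOb x)).symm
  have h1 := hH.isPointColimit (fixCat_isCocomplete M) h0
  rw [Category.id_comp] at h1
  have h2 : IsPointColimit (joinPresheaf (fixCat M) (fixOb '' s)) H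
      (fixOb (sSup ((fun x => (QFunctor.obj H (fixOb x)).1) '' s))) := by
    refine isPointColimit_joinPresheaf.2 fun g z a => ?_
    rw [le_fixCat_hom_iff, Set.forall_mem_image]
    change modAct N a.f (sSup _) ≤ z.1 ↔ _
    rw [sSup_image']
    simp only [modAct_iSup, iSup_le_iff, Subtype.forall]
    exact forall₂_congr fun x _ => (le_fixCat_hom_iff (y := QFunctor.obj H (fixOb x))).symm
  exact le_antisymm (fixCat_le_iff.1 (h1.unique h2)) (fixCat_le_iff.1 (h2.unique h1))

/-- The natural transformation of modules induced by a cocontinuous functor. -/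
def natOfCocont {M N : QMod Q} (H : fixCat M ⟶ fixCat N) (hH : IsCocontinuous H) : M ⟶ N :=
  NatTrans.mk
    (fun X => (⟨fun x => (QFunctor.obj H (fixOb (M := M) (X := X.unop) x)).1,
      fixMap_obj_sSup hH⟩ : sSupHom (M.functor.obj X).carrier (N.functor.obj X).carrier))
    (fun X Y b => by
      refine sSupHom.ext fun y => ?_
      exact fixMap_obj_act hH ((Idempotents.toKaroubi Q).map b.unop) (fixOb (M := M) y))

theorem fixMap_natOfCocont {M N : QMod Q} (H : fixCat M ⟶ fixCat N) (hH : IsCocontinuous H) :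
    fixMap (natOfCocont H hH) = H := by
  apply QFunctor.ext
  funext e x
  refine Subtype.ext ?_
  -- An element fixed by `e` is the tensor, along the inclusion of `e` into an identity, of itself
  -- seen at identity type. So `H` is determined by its values at identity types.
  let b : e ⟶ idm e.X := ⟨e.p, by simp⟩
  have h1 := fixMap_obj_act hH b (fixOb x.1)
  have h2 : (⟨modAct M b.f (fixOb x.1).1, modAct_left_fixed b _⟩ : (fixCat M).Ob e) = x :=
    Subtype.ext x.2
  rw [h2] at h1
  exact (QFunctor.obj (fixMap (natOfCocont H hH)) x).2.symm.trans h1.symm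

theorem fixMap_le_iff {M N : QMod Q} {α β : M ⟶ N} : fixMap α ≤ fixMap β ↔ α ≤ β :=
  ⟨fun h X x => fixCat_le_iff.1 (h (idm X.unop) (fixOb (M := M) x)),
    fun h e x => fixCat_le_iff.2 (h (Opposite.op e.X) x.1)⟩

end Comparison

end QSup

namespace QSup

/-! ### Tensors and joins on isomorphism classes of objects of a cocomplete category. -/

section ModuleOfCocomplete

variable {R : Type u} [Category.{u} R] [Quantaloid R]

theorem IsCocomplete.exists_tensor {C : QCat R} (hC : IsCocomplete C) {X Y : R} (b : X ⟶ Y)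
    (c : C.Ob Y) : ∃ k : C.Ob X, ∀ (Z : R) (d : C.Ob Z) (f : Z ⟶ X),
      f ≤ C.hom k d ↔ f ≫ b ≤ C.hom c d := by
  obtain ⟨S, hS⟩ := hC.exists_isSupFunctor
  exact ⟨_, isPointColimit_tensorPresheaf.1 (hS X (tensorPresheaf C b c))⟩

theorem IsCocomplete.exists_join {C : QCat R} (hC : IsCocomplete C) {X : R} (s : Set (C.Ob X)) :
    ∃ k : C.Ob X, ∀ (Z : R) (d : C.Ob Z) (f : Z ⟶ X),
      f ≤ C.hom k d ↔ ∀ c ∈ s, f ≤ C.hom c d := by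
  obtain ⟨S, hS⟩ := hC.exists_isSupFunctor
  exact ⟨_, isPointColimit_joinPresheaf.1 (hS X (joinPresheaf C s))⟩

/-- The tensor of `c` with `b`. -/
noncomputable def IsCocomplete.tensor {C : QCat R} (hC : IsCocomplete C) {X Y : R} (b : X ⟶ Y)
    (c : C.Ob Y) : C.Ob X :=
  (hC.exists_tensor b c).choose

theorem IsCocomplete.le_hom_tensor_iff {C : QCat R} (hC : IsCocomplete C) {X Y Z : R} {b : X ⟶ Y}
    {c : C.Ob Y} {d : C.Ob Z} {f : Z ⟶ X} : f ≤ C.hom (hC.tensor b c) d ↔ f ≫ b ≤ C.hom c d :=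
  (hC.exists_tensor b c).choose_spec Z d f

theorem IsCocomplete.tensor_le_iff {C : QCat R} (hC : IsCocomplete C) {X Y : R} {b : X ⟶ Y}
    {c : C.Ob Y} {d : C.Ob X} : hC.tensor b c ≤ d ↔ b ≤ C.hom c d := by
  refine hC.le_hom_tensor_iff.trans ?_
  rw [Category.id_comp]

theorem IsCocomplete.le_hom_tensor {C : QCat R} (hC : IsCocomplete C) {X Y : R} (b : X ⟶ Y)
    (c : C.Ob Y) : b ≤ C.hom c (hC.tensor b c) :=
  hC.tensor_le_iff.1 le_rfl

/-- The join of a set of objects of a fixed type. -/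
noncomputable def IsCocomplete.join {C : QCat R} (hC : IsCocomplete C) {X : R}
    (s : Set (C.Ob X)) : C.Ob X :=
  (hC.exists_join s).choose

theorem IsCocomplete.le_hom_join_iff {C : QCat R} (hC : IsCocomplete C) {X Z : R}
    {s : Set (C.Ob X)} {d : C.Ob Z} {f : Z ⟶ X} :
    f ≤ C.hom (hC.join s) d ↔ ∀ c ∈ s, f ≤ C.hom c d :=
  (hC.exists_join s).choose_spec Z d f

/-- Isomorphism classes of objects of a fixed type. -/
abbrev QCat.Cls (C : QCat R) (X : R) : Type u := Antisymmetrization (C.Ob X) (· ≤ ·)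

/-- The isomorphism class of an object. -/
abbrev QCat.cls {C : QCat R} {X : R} (c : C.Ob X) : C.Cls X :=
  toAntisymmetrization (· ≤ ·) c

/-- A representative of an isomorphism class of objects. -/
noncomputable abbrev QCat.rep {C : QCat R} {X : R} (q : C.Cls X) : C.Ob X :=
  ofAntisymmetrization (· ≤ ·) q

theorem QCat.cls_rep {C : QCat R} {X : R} (q : C.Cls X) : QCat.cls (QCat.rep q) = q :=
  toAntisymmetrization_ofAntisymmetrization _ q

theorem QCat.rep_le_rep_iff {C : QCat R} {X : R} {q r : C.Cls X} :
    QCat.rep q ≤ QCat.rep r ↔ q ≤ r :=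
  ofAntisymmetrization_le_ofAntisymmetrization_iff

theorem QCat.rep_cls_le {C : QCat R} {X : R} (c : C.Ob X) : QCat.rep (QCat.cls c) ≤ c :=
  toAntisymmetrization_le_toAntisymmetrization_iff.1 (QCat.cls_rep (QCat.cls c)).le

theorem QCat.le_rep_cls {C : QCat R} {X : R} (c : C.Ob X) : c ≤ QCat.rep (QCat.cls c) :=
  toAntisymmetrization_le_toAntisymmetrization_iff.1 (QCat.cls_rep (QCat.cls c)).ge

theorem QCat.cls_le_iff {C : QCat R} {X : R} {c : C.Ob X} {q : C.Cls X} :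
    QCat.cls c ≤ q ↔ c ≤ QCat.rep q := by
  rw [← QCat.rep_le_rep_iff]
  exact ⟨(QCat.le_rep_cls c).trans, (QCat.rep_cls_le c).trans⟩

theorem QCat.hom_rep_cls {C : QCat R} {X Y : R} (c : C.Ob X) (d : C.Ob Y) :
    C.hom (QCat.rep (QCat.cls c)) d = C.hom c d :=
  le_antisymm (C.hom_anti_left (QCat.le_rep_cls c) d) (C.hom_anti_left (QCat.rep_cls_le c) d)

/-- In a cocomplete category, the objects of a fixed type form a complete lattice, up to
isomorphism. -/
noncomputable abbrev IsCocomplete.clsLattice {C : QCat R} (hC : IsCocomplete C) (X : R) :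
    CompleteLattice (C.Cls X) :=
  letI : SupSet (C.Cls X) := ⟨fun T => QCat.cls (hC.join (QCat.rep '' T))⟩
  completeLatticeOfSup (C.Cls X) fun T => by
    have h (r : C.Cls X) : sSup T ≤ r ↔ ∀ q ∈ T, q ≤ r := by
      refine QCat.cls_le_iff.trans (hC.le_hom_join_iff.trans (Set.forall_mem_image.trans ?_))
      exact forall₂_congr fun q _ => QCat.rep_le_rep_iff
    exact ⟨(h _).1 le_rfl, fun r hr => (h r).2 hr⟩

/-- The join is universal for hom-arrows to objects of every type, not only for the order on one
fibre; this is what makes tensoring preserve joins. -/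
theorem IsCocomplete.le_hom_rep_sSup_iff {C : QCat R} (hC : IsCocomplete C) {X Z : R}
    {T : Set (C.Cls X)} {d : C.Ob Z} {f : Z ⟶ X} :
    f ≤ C.hom (QCat.rep ((hC.clsLattice X).sSup T)) d ↔ ∀ q ∈ T, f ≤ C.hom (QCat.rep q) d := by
  change f ≤ C.hom (QCat.rep (QCat.cls (hC.join (QCat.rep '' T)))) d ↔ _
  rw [QCat.hom_rep_cls, hC.le_hom_join_iff, Set.forall_mem_image]

/-- The action of an arrow on isomorphism classes, by tensors. -/
noncomputable def IsCocomplete.clsAct {C : QCat R} (hC : IsCocomplete C) {X Y : R} (b : X ⟶ Y)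
    (q : C.Cls Y) : C.Cls X :=
  QCat.cls (hC.tensor b (QCat.rep q))

theorem IsCocomplete.le_hom_clsAct_iff {C : QCat R} (hC : IsCocomplete C) {X Y Z : R} {b : X ⟶ Y}
    {q : C.Cls Y} {d : C.Ob Z} {f : Z ⟶ X} :
    f ≤ C.hom (QCat.rep (hC.clsAct b q)) d ↔ f ≫ b ≤ C.hom (QCat.rep q) d := by
  rw [IsCocomplete.clsAct, QCat.hom_rep_cls, hC.le_hom_tensor_iff]

theorem IsCocomplete.clsAct_le_iff {C : QCat R} (hC : IsCocomplete C) {X Y : R} {b : X ⟶ Y}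
    {q : C.Cls Y} {r : C.Cls X} :
    hC.clsAct b q ≤ r ↔ b ≤ C.hom (QCat.rep q) (QCat.rep r) :=
  QCat.cls_le_iff.trans hC.tensor_le_iff

theorem IsCocomplete.clsAct_id {C : QCat R} (hC : IsCocomplete C) {X : R} (q : C.Cls X) :
    hC.clsAct (𝟙 X) q = q :=
  eq_of_forall_ge_iff fun _ => hC.clsAct_le_iff.trans QCat.rep_le_rep_iff

theorem IsCocomplete.clsAct_comp {C : QCat R} (hC : IsCocomplete C) {X Y Z : R} (b : X ⟶ Y)
    (c : Y ⟶ Z) (q : C.Cls Z) : hC.clsAct (b ≫ c) q = hC.clsAct b (hC.clsAct c q) :=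
  eq_of_forall_ge_iff fun _ => by
    rw [hC.clsAct_le_iff, hC.clsAct_le_iff, hC.le_hom_clsAct_iff]

end ModuleOfCocomplete

/-! ### Each object of `Idm(Q)` is a retract of an identity. -/

section Idempotents

variable {Q : Type u} [Category.{u} Q]

/-- An idempotent as a retract of an identity. -/
def idmIncl (e : Idm Q) : e ⟶ idm e.X :=
  Idempotents.Karoubi.decompId_i e

/-- The retraction onto an idempotent. -/
def idmProj (e : Idm Q) : idm e.X ⟶ e :=
  Idempotents.Karoubi.decompId_p e

theorem idmIncl_comp_idmProj (e : Idm Q) : idmIncl e ≫ idmProj e = 𝟙 e :=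
  (Idempotents.Karoubi.decompId e).symm

theorem idmProj_comp_idmIncl (e : Idm Q) :
    idmProj e ≫ idmIncl e = (Idempotents.toKaroubi Q).map e.p :=
  (Idempotents.Karoubi.decomp_p e).symm

theorem idmIncl_naturality {e f : Idm Q} (b : e ⟶ f) :
    b ≫ idmIncl f = idmIncl e ≫ (Idempotents.toKaroubi Q).map b.f :=
  Idempotents.Karoubi.decompId_i_naturality b

theorem idmProj_naturality {e f : Idm Q} (b : e ⟶ f) :
    idmProj e ≫ b = (Idempotents.toKaroubi Q).map b.f ≫ idmProj f :=
  Idempotents.Karoubi.decompId_p_naturality b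

end Idempotents

/-! ### Every cocomplete category over `Idm(Q)` is equivalent to a fixed-point category. -/

section EssentialSurjectivity

variable {Q : Type u} [Category.{u} Q] [Quantaloid Q]

/-- The functor underlying the module of a cocomplete category. -/
noncomputable def clsFunctor {C : QCat (Idm Q)} (hC : IsCocomplete C) : Qᵒᵖ ⥤ SupLat.{u} where
  obj X := @SupLat.mk (C.Cls (idm X.unop)) (hC.clsLattice _)
  map {X Y} b :=
    letI := hC.clsLattice (idm X.unop)
    letI := hC.clsLattice (idm Y.unop)
    (⟨hC.clsAct ((Idempotents.toKaroubi Q).map b.unop), fun T =>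
      eq_of_forall_ge_iff fun r => by
        rw [hC.clsAct_le_iff, hC.le_hom_rep_sSup_iff, sSup_le_iff, Set.forall_mem_image]
        exact forall₂_congr fun q _ => hC.clsAct_le_iff.symm⟩ :
      sSupHom (C.Cls (idm X.unop)) (C.Cls (idm Y.unop)))
  map_id X := by
    let _ := hC.clsLattice (idm X.unop)
    exact sSupHom.ext fun q => hC.clsAct_id q
  map_comp {X Y Z} b c := by
    let _ := hC.clsLattice (idm X.unop)
    let _ := hC.clsLattice (idm Z.unop)
    exact sSupHom.ext fun q => hC.clsAct_comp ((Idempotents.toKaroubi Q).map c.unop)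
      ((Idempotents.toKaroubi Q).map b.unop) q

/-- The module on `Q` of a cocomplete category enriched in `Idm(Q)`. -/
noncomputable def modOfCocont {C : QCat (Idm Q)} (hC : IsCocomplete C) : QMod Q where
  functor := clsFunctor hC
  map_sSup {X Y} S := by
    let _ := hC.clsLattice (idm X.unop)
    let _ := hC.clsLattice (idm Y.unop)
    -- Since `b · q ≤ r` iff `b ≤ C(q, r)`, acting on a fixed `q` has a right adjoint in the
    -- variable `b`, so it preserves suprema of arrows.
    refine sSupHom.ext fun q => eq_of_forall_ge_iff fun r => hC.clsAct_le_iff.trans ?_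
    change (⨆ f : S, f.1.unop) ≤ (C.hom (QCat.rep q) (QCat.rep r)).f ↔
      (⨆ f : (fun b : X ⟶ Y => (clsFunctor hC).map b) '' S, SupLat.fn f.1 q) ≤ r
    rw [iSup_le_iff, iSup_le_iff]
    have h (b : X ⟶ Y) : b.unop ≤ (C.hom (QCat.rep q) (QCat.rep r)).f ↔
        SupLat.fn ((clsFunctor hC).map b) q ≤ r :=
      (hC.clsAct_le_iff (b := (Idempotents.toKaroubi Q).map b.unop)).symm
    constructor
    · rintro hr ⟨_, b, hb, rfl⟩
      exact (h b).1 (hr ⟨b, hb⟩)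
    · exact fun hr b => (h b.1).2 (hr ⟨_, b.1, b.2, rfl⟩)

theorem modAct_modOfCocont_le_iff {C : QCat (Idm Q)} (hC : IsCocomplete C) {X Y : Q} {b : X ⟶ Y}
    {q : modElt (modOfCocont hC) Y} {r : modElt (modOfCocont hC) X} :
    modAct (modOfCocont hC) b q ≤ r ↔
      (Idempotents.toKaroubi Q).map b ≤ C.hom (QCat.rep q) (QCat.rep r) :=
  hC.clsAct_le_iff

/-- The category of fixed points of the module of `C` is sent to `C` by tensoring with
inclusions of idempotents. -/
noncomputable def ofFixCat {C : QCat (Idm Q)} (hC : IsCocomplete C) :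
    fixCat (modOfCocont hC) ⟶ C := QFunctor.mk
  (fun {e} x => hC.tensor (idmIncl e) (QCat.rep x.1))
  (fun {e f} y x => hC.le_hom_tensor_iff.2 (by
    have h := (modAct_modOfCocont_le_iff hC).1 ((le_fixCat_hom_iff (y := y) (x := x)).1 le_rfl)
    rw [idmIncl_naturality]
    exact (comp_mono (hC.le_hom_tensor _ _) h).trans (C.hom_comp_le _ _ _)))

/-- The objects of `C` as fixed points of its module, by tensoring with projections onto
idempotents. -/
noncomputable def toFixCat {C : QCat (Idm Q)} (hC : IsCocomplete C) :
    C ⟶ fixCat (modOfCocont hC) := QFunctor.mk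
  (fun {e} c => ⟨QCat.cls (hC.tensor (idmProj e) c), by
    -- The idempotent is its projection followed by its inclusion; composing with the projection
    -- once more cancels the inclusion, so acting by `e` changes nothing.
    refine eq_of_forall_ge_iff fun r => (modAct_modOfCocont_le_iff hC).trans
      (Iff.trans ?_ QCat.cls_le_iff.symm)
    rw [QCat.hom_rep_cls, hC.le_hom_tensor_iff, hC.tensor_le_iff, ← idmProj_comp_idmIncl,
      Category.assoc, idmIncl_comp_idmProj, Category.comp_id]⟩)
  (fun {e f} c' c => le_fixCat_hom_iff.2 ((modAct_modOfCocont_le_iff hC).2 (by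
    rw [QCat.hom_rep_cls, hC.le_hom_tensor_iff, ← idmProj_naturality]
    refine (comp_mono ((hC.le_hom_tensor _ _).trans (C.hom_mono_right (QCat.le_rep_cls _) c))
      le_rfl).trans (C.hom_comp_le _ _ _))))

/-- The round trip tensors `c` with the inclusion followed by the projection, which is the identity
on `e`. -/
theorem toFixCat_comp_ofFixCat {C : QCat (Idm Q)} (hC : IsCocomplete C) :
    toFixCat hC ≫ ofFixCat hC ≈₂ 𝟙 C := by
  have h {e : Idm Q} (c d : C.Ob e) :
      QFunctor.obj (ofFixCat hC) (QFunctor.obj (toFixCat hC) c) ≤ d ↔ c ≤ d := by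
    refine hC.tensor_le_iff.trans ?_
    change _ ≤ C.hom (QCat.rep (QCat.cls (hC.tensor (idmProj e) c))) d ↔ _
    rw [QCat.hom_rep_cls, hC.le_hom_tensor_iff, idmIncl_comp_idmProj]
    exact Iff.rfl
  exact ⟨fun e c => (h c c).2 le_rfl, fun e c => (h c _).1 le_rfl⟩

/-- In this order the composite arrow is the idempotent itself, and acting by it fixes the given
element. -/
theorem ofFixCat_comp_toFixCat {C : QCat (Idm Q)} (hC : IsCocomplete C) :
    ofFixCat hC ≫ toFixCat hC ≈₂ 𝟙 (fixCat (modOfCocont hC)) := by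
  have h {e : Idm Q} (x y : (fixCat (modOfCocont hC)).Ob e) :
      QFunctor.obj (toFixCat hC) (QFunctor.obj (ofFixCat hC) x) ≤ y ↔ x ≤ y := by
    refine fixCat_le_iff.trans (QCat.cls_le_iff.trans ?_)
    refine hC.tensor_le_iff.trans (hC.le_hom_tensor_iff.trans ?_)
    rw [idmProj_comp_idmIncl]
    exact (modAct_modOfCocont_le_iff hC).symm.trans
      (le_fixCat_hom_iff (b := 𝟙 e) (y := x) (x := y)).symm
  exact ⟨fun e c => (h c c).2 le_rfl, fun e c => (h c _).1 le_rfl⟩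

theorem isCocontinuous_of_unit_counit {R : Type u} [Category.{u} R] [Quantaloid R] {C D : QCat R}
    {L : C ⟶ D} {G : D ⟶ C} (h1 : 𝟙 C ≤ L ≫ G) (h2 : G ≫ L ≤ 𝟙 D) : IsCocontinuous L := by
  refine isCocontinuous_of_adjoint L G fun {X Y} c d => le_antisymm ?_ ?_
  · exact (QFunctor.hom_le G _ _).trans (C.hom_anti_left (h1 _ c) _)
  · exact (QFunctor.hom_le L _ _).trans (D.hom_mono_right (h2 _ d) _)

theorem modToCocont_isBiequivalence : (modToCocont Q).IsBiequivalence := by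
  refine ⟨fun M N => ⟨fun α β => fixMap_le_iff.symm, fun H => ?_⟩, fun C => ?_⟩
  · exact ⟨natOfCocont H.1 H.2, AntisymmRel.of_eq (Subtype.ext (fixMap_natOfCocont H.1 H.2))⟩
  · have h1 := toFixCat_comp_ofFixCat C.cocomplete
    have h2 := ofFixCat_comp_toFixCat C.cocomplete
    -- An equivalence is an adjunction in both directions, so both functors are cocontinuous and the
    -- equivalence lives among cocomplete categories.
    exact ⟨modOfCocont C.cocomplete,
      ⟨ofFixCat C.cocomplete, isCocontinuous_of_unit_counit h2.2 h1.1⟩,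
      ⟨toFixCat C.cocomplete, isCocontinuous_of_unit_counit h1.2 h2.1⟩, h2, h1⟩

end EssentialSurjectivity

end QSup

theorem theorem3p3 (Q : Type u) [Category.{u} Q] [Quantaloid Q] :
    -- the presheaf construction is left adjoint to the forgetful functor, with the Yoneda
    -- embeddings as unit
    IsLeftAdjoint₂ (presheafFunctor (Idm Q)) (forgetCocont (Idm Q)) (yonedaUnit (Idm Q)) ∧
    -- the presheaf monad is the one induced by this adjunction: by construction its functor part
    -- is `U P` and its unit is the unit above, and its multiplication is `U ε P`
    (∀ A : QOrd Q,
      ∃ ε : (presheafFunctor (Idm Q)).obj ((forgetCocont (Idm Q)).obj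
          ((presheafFunctor (Idm Q)).obj A)) ⟶ (presheafFunctor (Idm Q)).obj A,
        (yonedaUnit (Idm Q)).app ((forgetCocont (Idm Q)).obj ((presheafFunctor (Idm Q)).obj A)) ≫
          (forgetCocont (Idm Q)).map ε ≈₂ 𝟙 _ ∧
        (presheafMonad (Idm Q)).μ.app A = (forgetCocont (Idm Q)).map ε) ∧
    -- it is a KZ doctrine on `Ord(Q)`
    (presheafMonad (Idm Q)).IsKZ ∧
    -- `Mod(Q)`, `Cocont(Idm(Q))` and the category of algebras are biequivalent, the second
    -- biequivalence being compatible with the forgetful functors to `Ord(Q)`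
    ∃ (G : TwoFunctor (QMod Q) (Cocont (Idm Q)))
      (K : TwoFunctor (Cocont (Idm Q)) (Alg (presheafMonad (Idm Q)))),
      G.IsBiequivalence ∧ K.IsBiequivalence ∧ (G.comp K).IsBiequivalence ∧
      K.toFunctor ⋙ (Alg.forget (presheafMonad (Idm Q))).toFunctor =
        (forgetCocont (Idm Q)).toFunctor := by
  exact ⟨isLeftAdjoint₂_presheafFunctor (Idm Q), presheafMonad_mul (Idm Q),
    presheafMonad_isKZ (Idm Q), modToCocont Q, cocontToAlg (Idm Q), modToCocont_isBiequivalence,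
    cocontToAlg_isBiequivalence,
    modToCocont_isBiequivalence.comp cocontToAlg_isBiequivalence, rfl⟩
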